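/- Assume $\mathrm{NP}\nsubseteq\mathrm{P/poly}$. Then there exists a weighted language $\tilde p:\{0,1\}^*\to\mathbb{R}_{\ge 0}$ such that: (i) $\tilde p$ is normalizable, i.e. $Z=\sum_{x}\tilde p(x)$ is finite and strictly positive; (ii) $\tilde p$ is efficiently computable, i.e. its values are rational and a deterministic Turing machine computes $\tilde p(x)$ from $x$ in time polynomial in $|x|$; (iii) for every real $\lambda\ge 1$ there are no deterministic Turing machine $M$ and parameter strings $\theta_n\in\{0,1\}^*$ ($n\in\mathbb{N}$) satisfying all of the following: - the length $|\theta_n|$ is $O(\mathrm{poly}(n))$; - on input $\theta_n$, $M$ runs in time $O(\mathrm{poly}(n))$ and outputs (the description of) a probabilistic Turing machine $q_n$ that maps each input $\hat x x$ with $\hat x\in\{0,1\}^*$, $|\hat x|\le n$ and $x\in\{0,1,\$\}$ to a random number in $\mathbb{Q}\cap[0,1]$; - the worst-case runtime of $q_n$ on these inputs (which have length at most $n+1$) is $O(\mathrm{poly}(n))$; - for all $\hat x\in\{0,1\}^*$ with $|\hat x|\le n$ and all $x\in\{0,1,\$\}$ with $p(x\mid\hat x)>0$, with probability greater than $2/3$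 the output $r=q_n(\hat x x)$ approximates $p(x\mid\hat x)$ to within a factor of $\lambda$, that is, $r/\lambda\le p(x\mid\hat x)\le\lambda r$. Here $Z(\hat x)$ is the sum of $\tilde p(y)$ over all strings $y$ that have $\hat x$ as a prefix, and, whenever $Z(\hat x)>0$, the local conditional probabilities are $p(x\mid\hat x)=Z(\hat x x)/Z(\hat x)$ for $x\in\{0,1\}$ and $p(\$\mid\hat x)=\tilde p(\hat x)/Z(\hat x)$ for the end-of-string symbol $\$$. -/

import Mathlib

open scoped NNReal

namespace LocalNorm

/-! Deterministic Turing machines and the classes NP and P/poly -/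

/-- The deterministic multitape machine `M`, started on the input string `inp`, halts within `t`
steps with the output string `out`. -/
def Computes {A B : Type} (M : Turing.TM2ComputableAux A B) (inp : List A) (out : List B)
    (t : ℕ) : Prop :=
  Nonempty (Turing.TM2OutputsInTime M.tm (inp.map M.inputAlphabet.invFun)
    (some (out.map M.outputAlphabet.invFun)) t)

/-- The string `u#v` over `{0, 1, #}`, with `none` in the role of the separator `#`. -/
def pairEnc (u v : List Bool) : List (Option Bool) :=
  u.map some ++ none :: v.map some

/-- The class NP: there are a polynomial-time verifier `V`, which outputs the verdict `v x w` on
every input `x#w`, and a polynomial `p` such that `x ∈ L` iff some witness of length `p(|x|)` is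
accepted together with `x`. -/
def NP : Set (Language Bool) :=
  {L | ∃ (V : Turing.TM2ComputableAux (Option Bool) Bool) (v : List Bool → List Bool → Bool)
      (p t : Polynomial ℕ),
    (∀ x w, Computes V (pairEnc x w) [v x w] (t.eval (x.length + w.length))) ∧
    ∀ x, x ∈ L ↔ ∃ w : List Bool, w.length = p.eval x.length ∧ v x w = true}

open Classical in
/-- The class P/poly: there are a machine `M` and advice strings `α n` of polynomial length such
that `M`, on input `α(|x|)#x`, decides in time polynomial in `|x|` whether `x ∈ L`. -/
noncomputable def PPoly : Set (Language Bool) :=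
  {L | ∃ (M : Turing.TM2ComputableAux (Option Bool) Bool) (α : ℕ → List Bool)
      (p t : Polynomial ℕ),
    (∀ n, (α n).length ≤ p.eval n) ∧
    ∀ x, Computes M (pairEnc (α x.length) x) [decide (x ∈ L)] (t.eval x.length)}

/-! Weighted languages -/

/-- The natural number with the given binary digits, least significant digit first. -/
def binValue (l : List Bool) : ℕ := Nat.ofDigits 2 (l.map Bool.toNat)

/-- The string `s = u#v` represents the rational number `r = u / v`, with `u` and `v` written in
binary and `v ≠ 0`. -/
def RepresentsRat (s : List (Option Bool)) (r : ℚ) : Prop :=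
  ∃ u v : List Bool, s = pairEnc u v ∧ binValue v ≠ 0 ∧ r = (binValue u : ℚ) / binValue v

/-- A weighted language over the alphabet `{0, 1}`. -/
abbrev WeightedLanguage : Type := List Bool → ℝ≥0

/-- The global normalizing constant `Z` is finite and strictly positive. -/
def Normalizable (p : WeightedLanguage) : Prop :=
  Summable p ∧ 0 < ∑' x, p x

/-- `Z(y)`, the total weight of all strings that have `y` as a prefix. -/
noncomputable def prefixWeight (p : WeightedLanguage) (y : List Bool) : ℝ≥0 :=
  ∑' x : {x : List Bool // y <+: x}, p x

/-- The local conditional probability `p(a | y)` of the next symbol `a`, where `none` is the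
end-of-string symbol `$`: it is `Z(ya) / Z(y)` for `a ∈ {0, 1}`, and the weight of `y` divided by
`Z(y)` for `$`. Only meaningful if `Z(y) > 0`; otherwise the value is `0`. -/
noncomputable def localProb (p : WeightedLanguage) (y : List Bool) : Option Bool → ℝ≥0
  | some a => prefixWeight p (y ++ [a]) / prefixWeight p y
  | none => p y / prefixWeight p y

/-- A deterministic Turing machine maps every `x` to the (rational) weight of `x`, in time
polynomial in `|x|`. -/
def EfficientlyComputable (p : WeightedLanguage) : Prop :=
  ∃ (M : Turing.TM2ComputableAux Bool (Option Bool)) (t : Polynomial ℕ),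
    ∀ x, ∃ (s : List (Option Bool)) (r : ℚ),
      Computes M x s (t.eval x.length) ∧ RepresentsRat s r ∧ (r : ℝ) = p x

/-! Probabilistic Turing machines, as finite objects that another machine can write down -/

/-- What a machine does in one step: enter state `next`, write the symbol `write`, move the head
by one cell. -/
structure Action where
  next : ℕ
  write : ℕ
  dir : Turing.Dir

/-- A rule of a probabilistic machine: in state `state`, with the symbol `read` under the head,
perform `act₀` or `act₁`, according to the outcome of a fair coin. -/
structure Rule where
  state : ℕ
  read : ℕ
  act₀ : Action
  act₁ : Action

/-- A probabilistic single-tape Turing machine, given by the finite table of its two transition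
functions. States and tape symbols are the natural numbers that occur in the table; the start
state is `0`, and so is the blank symbol. -/
structure PTM where
  rules : List Rule

/-- A configuration: state, and tape with head position. -/
structure PTM.Cfg where
  state : ℕ
  tape : Turing.Tape ℕ

namespace PTM

/-- The rule that applies in a configuration (the first one in the table, should there be more
than one), if any. -/
def ruleAt (c : PTM) (s : Cfg) : Option Rule :=
  c.rules.find? fun r => r.state == s.state && r.read == s.tape.head

/-- The machine has halted when no rule applies. -/
def Halted (c : PTM) (s : Cfg) : Prop := c.ruleAt s = none

/-- One step with coin `b`. A halted machine stays as it is. -/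
def step (c : PTM) (s : Cfg) (b : Bool) : Cfg :=
  match c.ruleAt s with
  | none => s
  | some r =>
    let a := if b then r.act₁ else r.act₀
    ⟨a.next, (s.tape.write a.write).move a.dir⟩

/-- The tape symbols for `0`, `1` and the third symbol `none` (which is `$` in inputs and `#` in
outputs). The blank is `0`. -/
def symbol : Option Bool → ℕ
  | some false => 1
  | some true => 2
  | none => 3

/-- The initial configuration: the input is on the tape, the head on its first symbol. -/
def init (inp : List (Option Bool)) : Cfg :=
  ⟨0, Turing.Tape.mk₁ (inp.map symbol)⟩

/-- The configuration after as many steps as there are coins. -/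
def run (c : PTM) (inp : List (Option Bool)) {t : ℕ} (coins : Fin t → Bool) : Cfg :=
  (List.ofFn coins).foldl c.step (init inp)

/-- The machine has halted, and the tape from the head to the right holds a representation of the
rational number `r`, followed by blanks. -/
def Outputs (c : PTM) (s : Cfg) (r : ℚ) : Prop :=
  c.Halted s ∧ ∃ out, RepresentsRat out r ∧
    s.tape.right₀ = Turing.ListBlank.mk (out.map symbol)

/-- The probability, over `t` independent fair coins, that the configuration of `c` after `t` steps
on input `inp` has the property `E`. -/
noncomputable def prob (c : PTM) (inp : List (Option Bool)) (t : ℕ) (E : Cfg → Prop) : ℝ :=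
  (Nat.card {coins : Fin t → Bool // E (c.run inp coins)} : ℝ) / 2 ^ t

/-- Binary description of a natural number, in unary with an end marker. -/
def encodeNat (n : ℕ) : List Bool := List.replicate n true ++ [false]

/-- Binary description of an action. -/
def encodeAction (a : Action) : List Bool :=
  encodeNat a.next ++ encodeNat a.write ++ [decide (a.dir = Turing.Dir.right)]

/-- Binary description of a rule. -/
def encodeRule (r : Rule) : List Bool :=
  encodeNat r.state ++ encodeNat r.read ++ encodeAction r.act₀ ++ encodeAction r.act₁

/-- Binary description of a machine. -/
def encode (c : PTM) : List Bool := c.rules.flatMap encodeRule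

theorem encodeNat_append_inj {m n : ℕ} {u v : List Bool}
    (h : encodeNat m ++ u = encodeNat n ++ v) : m = n ∧ u = v := by
  induction m generalizing n with
  | zero => cases n <;> simp_all [encodeNat, List.replicate_succ]
  | succ m ih =>
    cases n with
    | zero => simp [encodeNat, List.replicate_succ] at h
    | succ n =>
      have := @ih n (by simpa [encodeNat, List.replicate_succ] using h)
      simpa using this

theorem encodeAction_append_inj {a b : Action} {u v : List Bool}
    (h : encodeAction a ++ u = encodeAction b ++ v) : a = b ∧ u = v := by
  obtain ⟨n, w, d⟩ := a
  obtain ⟨n', w', d'⟩ := b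
  simp only [encodeAction, List.append_assoc] at h
  obtain ⟨h1, hh⟩ := encodeNat_append_inj h
  obtain ⟨h2, hd⟩ := encodeNat_append_inj hh
  cases d <;> cases d' <;> simp_all

theorem encodeRule_append_inj {a b : Rule} {u v : List Bool}
    (h : encodeRule a ++ u = encodeRule b ++ v) : a = b ∧ u = v := by
  obtain ⟨s, r, a₀, a₁⟩ := a
  obtain ⟨s', r', b₀, b₁⟩ := b
  simp only [encodeRule, List.append_assoc] at h
  obtain ⟨h1, k1⟩ := encodeNat_append_inj h
  obtain ⟨h2, k2⟩ := encodeNat_append_inj k1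
  obtain ⟨h3, k3⟩ := encodeAction_append_inj k2
  obtain ⟨h4, k4⟩ := encodeAction_append_inj k3
  exact ⟨by rw [h1, h2, h3, h4], k4⟩

theorem encodeRule_ne_nil (r : Rule) : encodeRule r ≠ [] := by
  simp [encodeRule, encodeNat]

/-- A machine is determined by its description. -/
theorem encode_injective : Function.Injective encode := by
  rintro ⟨l⟩ ⟨l'⟩ h
  simp only [encode] at h
  congr 1
  induction l generalizing l' with
  | nil => cases l' <;> simp_all [encodeRule_ne_nil]
  | cons a l ih =>
    cases l' with
    | nil => simp_all [encodeRule_ne_nil]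
    | cons b l' =>
      simp only [List.flatMap_cons] at h
      obtain ⟨h1, h2⟩ := encodeRule_append_inj h
      rw [h1, ih l' h2]

end PTM

/-! Approximate local normalization -/

/-- `r` approximates `p` to within the factor `lam`. -/
def ApproxWithin (lam : ℝ) (r : ℚ) (p : ℝ) : Prop :=
  (r : ℝ) / lam ≤ p ∧ p ≤ lam * r

/-- The deterministic machine `M` with the parameters `θ` approximates the local conditional
probabilities of `p` to within the factor `lam`, efficiently, with compact parameters, and with the
help of randomness: the length of `θ n` is polynomial in `n`; on input `θ n` the machine `M` writes
in time polynomial in `n` the description of a probabilistic machine `q n`; on every input `ya`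
with `|y| ≤ n` and `a ∈ {0, 1, $}`, every run of `q n` halts within time polynomial in `n` with
a rational number in `[0, 1]` as output; and whenever `p(a | y) > 0`, this output is, with
probability greater than `2/3`, within the factor `lam` of `p(a | y)`. -/
def ApproximatelyLocallyNormalizes (lam : ℝ) (p : WeightedLanguage)
    (M : Turing.TM2ComputableAux Bool Bool) (θ : ℕ → List Bool) : Prop :=
  ∃ (q : ℕ → PTM) (size build time : Polynomial ℕ),
    (∀ n, (θ n).length ≤ size.eval n) ∧
    (∀ n, Computes M (θ n) (q n).encode (build.eval n)) ∧
    (∀ (n : ℕ) (y : List Bool) (a : Option Bool), y.length ≤ n →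
      ∀ coins : Fin (time.eval n) → Bool, ∃ r : ℚ, 0 ≤ r ∧ r ≤ 1 ∧
        (q n).Outputs ((q n).run (y.map some ++ [a]) coins) r) ∧
    ∀ (n : ℕ) (y : List Bool) (a : Option Bool), y.length ≤ n → 0 < localProb p y a →
      2 / 3 < (q n).prob (y.map some ++ [a]) (time.eval n)
        (fun s => ∃ r : ℚ, (q n).Outputs s r ∧ ApproxWithin lam r (localProb p y a))

end LocalNorm

/-! Given a language `L` in NP outside P/poly, give weight to strings that consist of an instance
`x` and either a witness accepted with `x` or a single fallback symbol. The weight of the fallback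
string is so small that the conditional probability of the fallback symbol after `x` is at most
`2⁻ᵏ` if `x` has a witness, while it is `1` otherwise. Hence whoever approximates this probability
to within a factor of `λ`, where `2ᵏ > λ²`, decides `L`. The approximations come from a
probabilistic machine, which errs with probability less than `1/3`. A majority vote over
sufficiently many runs errs on fewer than one in `2ⁿ` random strings, so that one random string
serves all inputs of length `n`, and the vote with this string fixed is computed by a circuit of
polynomial size. -/

namespace LocalNorm

open Turing StateTransition

/-! ### Runs of deterministic machines -/

section ReachesWithin

variable {σ σ' : Type*} {f : σ → Option σ} {f' : σ' → Option σ'} {a b c : σ} {s t : ℕ}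

/-- The partial transition function `f` leads from `a` to `b` in at most `t` steps. This is the
propositional form of `StateTransition.EvalsToInTime`; the time bound stands between the two
configurations, so that bounds of successive runs add up in reading order. -/
def ReachesWithin (f : σ → Option σ) (a : σ) (t : ℕ) (b : σ) : Prop :=
  Nonempty (EvalsToInTime f a (some b) t)

namespace ReachesWithin

theorem mono (h : ReachesWithin f a s b) (hst : s ≤ t) : ReachesWithin f a t b :=
  h.map fun e => ⟨e.toEvalsTo, e.steps_le_m.trans hst⟩

theorem refl (a : σ) : ReachesWithin f a 0 a :=
  ⟨EvalsToInTime.refl f a⟩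

theorem trans (h₁ : ReachesWithin f a s b) (h₂ : ReachesWithin f b t c) :
    ReachesWithin f a (s + t) c := by
  obtain ⟨e₁⟩ := h₁
  obtain ⟨e₂⟩ := h₂
  exact ⟨add_comm t s ▸ EvalsToInTime.trans f s t a b (some c) e₁ e₂⟩

theorem single (h : f a = some b) : ReachesWithin f a 1 b :=
  ⟨⟨⟨1, h⟩, le_rfl⟩⟩

theorem head (h : f a = some b) (h' : ReachesWithin f b t c) : ReachesWithin f a (t + 1) c :=
  add_comm 1 t ▸ (single h).trans h'

theorem exists_le_of_step {P : σ → ℕ → Prop} (h : ReachesWithin f a t b) (zero : P a 0)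
    (succ : ∀ c d k, P c k → f c = some d → P d (k + 1)) : ∃ k ≤ t, P b k := by
  obtain ⟨⟨⟨k, hrun⟩, hk⟩⟩ := h
  refine ⟨k, hk, ?_⟩
  clear hk
  induction k generalizing b with
  | zero => exact Option.some.inj hrun ▸ zero
  | succ k ih =>
    rw [Function.iterate_succ_apply'] at hrun
    obtain ⟨c, hc, hcb⟩ := Option.bind_eq_some_iff.1 hrun
    exact succ c b k (ih hc) hcb

theorem map (φ : σ → σ') (hφ : ∀ a b, f a = some b → f' (φ a) = some (φ b))
    (h : ReachesWithin f a t b) : ReachesWithin f' (φ a) t (φ b) := by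
  obtain ⟨k, hk, hrun⟩ := h.exists_le_of_step (P := fun c k => ReachesWithin f' (φ a) k (φ c))
    (refl _) fun c d k hc hd => hc.trans (single (hφ c d hd))
  exact hrun.mono hk

end ReachesWithin

end ReachesWithin

section Computes

variable {A B : Type} {M : TM2ComputableAux A B} {inp : List A} {out : List B} {s t : ℕ}

theorem computes_iff :
    Computes M inp out t ↔
      ReachesWithin (TM2.step M.tm.m) (initList M.tm (inp.map M.inputAlphabet.symm)) t
        (haltList M.tm (out.map M.outputAlphabet.symm)) :=
  Iff.rfl

theorem Computes.mono (h : Computes M inp out s) (hst : s ≤ t) : Computes M inp out t :=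
  ReachesWithin.mono h hst

theorem initList_eq {tm : FinTM2} {l : List (tm.Γ tm.k₀)} {S : ∀ k, List (tm.Γ k)}
    (h : S tm.k₀ = l) (h' : ∀ k, k ≠ tm.k₀ → S k = []) :
    initList tm l = ⟨some tm.main, tm.initialState, S⟩ := by
  subst h
  refine congrArg (TM2.Cfg.mk _ _) (funext fun k => ?_)
  by_cases hk : k = tm.k₀
  · subst hk
    exact dif_pos rfl
  · exact (dif_neg hk).trans (h' k hk).symm

theorem haltList_eq {tm : FinTM2} {l : List (tm.Γ tm.k₁)} {S : ∀ k, List (tm.Γ k)}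
    (h : S tm.k₁ = l) (h' : ∀ k, k ≠ tm.k₁ → S k = []) :
    haltList tm l = ⟨none, tm.initialState, S⟩ := by
  subst h
  refine congrArg (TM2.Cfg.mk _ _) (funext fun k => ?_)
  by_cases hk : k = tm.k₁
  · subst hk
    exact dif_pos rfl
  · exact (dif_neg hk).trans (h' k hk).symm

theorem length_initList_stk_le (tm : FinTM2) (l : List (tm.Γ tm.k₀)) (k : tm.K) :
    ((initList tm l).stk k).length ≤ l.length := by
  by_cases hk : k = tm.k₀
  · subst hk
    simp [initList]
  · simp [initList, hk]

theorem haltList_stk_output (tm : FinTM2) (l : List (tm.Γ tm.k₁)) :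
    (haltList tm l).stk tm.k₁ = l :=
  dif_pos rfl

/-- The largest number of symbols that a statement can push in one execution. -/
def maxPushes {K : Type*} {Γ : K → Type*} {Λ σ : Type*} : TM2.Stmt Γ Λ σ → ℕ
  | .push _ _ q => maxPushes q + 1
  | .peek _ _ q => maxPushes q
  | .pop _ _ q => maxPushes q
  | .load _ q => maxPushes q
  | .branch _ q₁ q₂ => max (maxPushes q₁) (maxPushes q₂)
  | .goto _ => 0
  | .halt => 0

theorem length_stepAux_stk_le {K : Type*} [DecidableEq K] {Γ : K → Type*} {Λ σ : Type*}
    (q : TM2.Stmt Γ Λ σ) (v : σ) (S : ∀ k, List (Γ k)) (k : K) :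
    ((TM2.stepAux q v S).stk k).length ≤ (S k).length + maxPushes q := by
  induction q generalizing v S with
  | push k' f q ih =>
    refine (ih _ _).trans ?_
    rcases eq_or_ne k k' with rfl | h
    · rw [Function.update_self, List.length_cons, maxPushes]
      omega
    · rw [Function.update_of_ne h, maxPushes]
      omega
  | peek _ _ _ ih => exact ih _ _
  | pop k' f q ih =>
    refine (ih _ _).trans ?_
    rcases eq_or_ne k k' with rfl | h
    · rw [Function.update_self, List.length_tail, maxPushes]
      omega
    · rw [Function.update_of_ne h, maxPushes]
  | load _ _ ih => exact ih _ _
  | branch f q₁ q₂ ih₁ ih₂ =>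
    rw [TM2.stepAux, maxPushes]
    cases f v
    · exact (ih₂ _ _).trans (Nat.add_le_add_left (le_max_right _ _) _)
    · exact (ih₁ _ _).trans (Nat.add_le_add_left (le_max_left _ _) _)
  | goto f => exact le_rfl
  | halt => exact le_rfl

theorem exists_length_output_le (M : TM2ComputableAux A B) :
    ∃ C : ℕ, ∀ inp out t, Computes M inp out t → out.length ≤ inp.length + C * t := by
  have := M.tm.ΛFin
  set C := Finset.univ.sup fun l => maxPushes (M.tm.m l)
  refine ⟨C, fun inp out t h => ?_⟩
  obtain ⟨k, hk, hlen⟩ := (computes_iff.1 h).exists_le_of_step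
    (P := fun c k => (c.stk M.tm.k₁).length ≤ inp.length + C * k)
    (by simpa using length_initList_stk_le M.tm (inp.map M.inputAlphabet.symm) M.tm.k₁) <| by
      rintro ⟨_ | l, v, S⟩ d k hlen hd
      · cases hd
      · obtain rfl : TM2.stepAux (M.tm.m l) v S = d := Option.some.inj hd
        have hpush : maxPushes (M.tm.m l) ≤ C :=
          Finset.le_sup (f := fun l => maxPushes (M.tm.m l)) (Finset.mem_univ l)
        calc _ ≤ (S M.tm.k₁).length + maxPushes (M.tm.m l) := length_stepAux_stk_le _ _ _ _
          _ ≤ inp.length + C * k + C := add_le_add hlen hpush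
          _ = inp.length + C * (k + 1) := by ring
  rw [haltList_stk_output, List.length_map] at hlen
  exact hlen.trans (by gcongr)

end Computes

/-! ### Boolean circuits and formulas -/

/-- A Boolean circuit, as a list of NAND gates. Each gate `(i, j)` reads the `i`-th and the `j`-th
most recent wire and puts its result on a new wire. -/
abbrev Circuit : Type := List (ℕ × ℕ)

/-- The value of the gate `g` on the wires `ws`, listed from the most recent to the oldest. Missing
wires carry the value `false`. -/
def gateValue (ws : List Bool) (g : ℕ × ℕ) : Bool :=
  !(ws.getD g.1 false && ws.getD g.2 false)

/-- The wires at the start of a computation on the input `x`: the bits of `x` and, as the oldest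
wire, the constant `true`. -/
def inputWires (x : List Bool) : List Bool := x.reverse ++ [true]

theorem length_inputWires (x : List Bool) : (inputWires x).length = x.length + 1 := by
  simp [inputWires]

namespace Circuit

/-- The wires after the evaluation of the circuit `C` on the wires `ws`. -/
def eval (C : Circuit) (ws : List Bool) : List Bool :=
  C.foldl (fun ws g => gateValue ws g :: ws) ws

theorem eval_cons (g : ℕ × ℕ) (C : Circuit) (ws : List Bool) :
    eval (g :: C) ws = eval C (gateValue ws g :: ws) := rfl

theorem eval_concat (C : Circuit) (g : ℕ × ℕ) (ws : List Bool) :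
    eval (C ++ [g]) ws = gateValue (eval C ws) g :: eval C ws := by
  simp [eval]

theorem length_eval (C : Circuit) (ws : List Bool) :
    (eval C ws).length = C.length + ws.length := by
  induction C generalizing ws with
  | nil => simp [eval]
  | cons g C ih =>
    rw [eval_cons, ih, List.length_cons, List.length_cons]
    omega

theorem getD_eval (C : Circuit) (ws : List Bool) (i : ℕ) :
    (eval C ws).getD (C.length + i) false = ws.getD i false := by
  induction C generalizing ws i with
  | nil => simp [eval]
  | cons g C ih =>
    rw [eval_cons, List.length_cons, add_assoc, add_comm 1, ih, List.getD_cons_succ]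

/-- The gates of the circuit read only existing wires or wires of later gates, if there are `n`
inputs and the constant wire. -/
def WellFormed (n : ℕ) (C : Circuit) : Prop :=
  ∀ g ∈ C, g.1 ≤ n + C.length ∧ g.2 ≤ n + C.length

theorem WellFormed.concat {n i j : ℕ} {C : Circuit} (h : WellFormed n C) (hi : i ≤ n + C.length)
    (hj : j ≤ n + C.length) : WellFormed n (C ++ [(i, j)]) := by
  intro g hg
  rw [List.length_append, List.length_singleton]
  rcases List.mem_append.1 hg with hg | hg
  · have := h g hg
    omega
  · obtain rfl := List.mem_singleton.1 hg
    constructor <;> dsimp only <;> omega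

end Circuit

/-- `f` is a NAND formula, with at most `k` gates, in the functions in `S` and the constant
`true`. -/
inductive Formula {X : Type*} (S : Set (X → Bool)) : ℕ → (X → Bool) → Prop
  | base {k f} : f ∈ S → Formula S k f
  | top {k} : Formula S k (fun _ => true)
  | nand {a b k f g} : Formula S a f → Formula S b g → a + b + 1 ≤ k →
      Formula S k (fun x => !(f x && g x))

namespace Formula

variable {X Y ι : Type*} {S S' : Set (X → Bool)} {a b k l : ℕ} {f g c : X → Bool}

theorem mono (h : Formula S k f) (hk : k ≤ l) : Formula S l f := by
  cases h with
  | base h => exact .base h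
  | top => exact .top
  | nand h₁ h₂ h => exact .nand h₁ h₂ (h.trans hk)

theorem subset (h : Formula S k f) (hS : S ⊆ S') : Formula S' k f := by
  induction h with
  | base h => exact .base (hS h)
  | top => exact .top
  | nand _ _ h ih₁ ih₂ => exact .nand ih₁ ih₂ h

theorem comp (h : Formula S k f) (φ : Y → X) : Formula ((· ∘ φ) '' S) k (f ∘ φ) := by
  induction h with
  | base h => exact .base ⟨_, h, rfl⟩
  | top => exact .top
  | nand _ _ h ih₁ ih₂ => exact .nand ih₁ ih₂ h

theorem not (h : Formula S a f) : Formula S (a + 1) (fun x => !f x) := by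
  simpa using Formula.nand h (.top (k := 0)) le_rfl

theorem const (b : Bool) : Formula S 1 (fun _ => b) := by
  cases b
  · exact Formula.not (.top (k := 0))
  · exact .top

theorem and (hf : Formula S a f) (hg : Formula S b g) :
    Formula S (a + b + 2) (fun x => f x && g x) := by
  simpa using (Formula.nand hf hg le_rfl).not

theorem or (hf : Formula S a f) (hg : Formula S b g) :
    Formula S (a + b + 3) (fun x => f x || g x) := by
  simpa using Formula.nand hf.not hg.not (k := a + b + 3) (by omega)

theorem ite (hc : Formula S k c) (hf : Formula S a f) (hg : Formula S b g) :
    Formula S (2 * k + a + b + 8) (fun x => bif c x then f x else g x) := by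
  convert ((hc.and hf).or (hc.not.and hg)).mono (l := 2 * k + a + b + 8) (by omega) using 2 with x
  cases c x <;> simp

theorem bool_comp (h : Formula S k f) (φ : Bool → Bool) :
    Formula S (k + 1) (fun x => φ (f x)) := by
  rcases Bool.eq_false_or_eq_true (φ true) with ht | ht <;>
    rcases Bool.eq_false_or_eq_true (φ false) with hf | hf
  · convert (const true).mono (Nat.le_add_left 1 k) using 2 with x
    cases f x <;> assumption
  · convert h.mono (Nat.le_succ k) using 2 with x
    cases f x <;> assumption
  · convert h.not using 2 with x
    cases f x <;> assumption
  · convert (const false).mono (Nat.le_add_left 1 k) using 2 with x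
    cases f x <;> assumption

theorem elim_find? (l : List ι) {m F : ι → X → Bool} (hm : ∀ i ∈ l, Formula S k (m i))
    (hF : ∀ i ∈ l, Formula S a (F i)) (hg : Formula S b g) :
    Formula S (l.length * (2 * k + a + 8) + b)
      (fun x => (l.find? fun i => m i x).elim (g x) fun i => F i x) := by
  induction l with
  | nil => simpa using hg
  | cons i l ih =>
    obtain ⟨hmi, hm⟩ := List.forall_mem_cons.1 hm
    obtain ⟨hFi, hF⟩ := List.forall_mem_cons.1 hF
    convert (hmi.ite hFi (ih hm hF)).mono (l := (i :: l).length * (2 * k + a + 8) + b) ?_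
      using 2 with x
    · rw [List.find?_cons]
      cases m i x <;> rfl
    · rw [List.length_cons, add_mul]
      omega

theorem any (l : List ι) (F : ι → X → Bool) (h : ∀ i ∈ l, Formula S k (F i)) :
    Formula S (l.length * (k + 3) + 1) (fun x => l.any fun i => F i x) := by
  induction l with
  | nil => exact (const false).mono (by simp)
  | cons i l ih =>
    obtain ⟨hi, hl⟩ := List.forall_mem_cons.1 h
    refine (hi.or (ih hl)).mono ?_
    rw [List.length_cons, add_mul]
    omega

theorem all (l : List ι) (F : ι → X → Bool) (h : ∀ i ∈ l, Formula S k (F i)) :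
    Formula S (l.length * (k + 4) + 2) (fun x => l.all fun i => F i x) := by
  simpa [List.not_any_eq_all_not, add_assoc] using
    (any l (fun i x => !F i x) fun i hi => (h i hi).not).not

end Formula

/-- Some circuit of size at most `s` with `n` inputs computes all functions in `S` at once. -/
def HasCircuit (n s : ℕ) (S : Set ((Fin n → Bool) → Bool)) : Prop :=
  ∃ C : Circuit, C.length ≤ s ∧ C.WellFormed n ∧ ∀ f ∈ S, ∃ i ≤ n + C.length,
    ∀ x : Fin n → Bool, (C.eval (inputWires (List.ofFn x))).getD i false = f x

namespace HasCircuit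

variable {n s t k : ℕ} {S S' : Set ((Fin n → Bool) → Bool)} {f g : (Fin n → Bool) → Bool}

theorem mono (h : HasCircuit n s S) (hs : s ≤ t) : HasCircuit n t S := by
  obtain ⟨C, hlen, hC⟩ := h
  exact ⟨C, hlen.trans hs, hC⟩

theorem subset (h : HasCircuit n s S) (hS : S' ⊆ S) : HasCircuit n s S' := by
  obtain ⟨C, hlen, hwf, hval⟩ := h
  exact ⟨C, hlen, hwf, fun f hf => hval f (hS hf)⟩

theorem range_apply (n : ℕ) : HasCircuit n 0 (Set.range fun i x => x i) := by
  refine ⟨[], le_rfl, by simp [Circuit.WellFormed], ?_⟩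
  rintro _ ⟨i, rfl⟩
  refine ⟨i.rev, by rw [Fin.val_rev, List.length_nil]; omega, fun x => ?_⟩
  have hi : (i.rev : ℕ) < (List.ofFn x).reverse.length := by simpa using i.pos
  change (inputWires (List.ofFn x)).getD _ _ = _
  rw [inputWires, List.getD_append _ _ _ _ hi, List.getD_eq_getElem _ _ hi, List.getElem_reverse,
    List.getElem_ofFn]
  congr 1
  ext
  simp only [List.length_ofFn, Fin.val_rev]
  omega

theorem insert_true (h : HasCircuit n s S) : HasCircuit n s (insert (fun _ => true) S) := by
  obtain ⟨C, hlen, hwf, hval⟩ := h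
  refine ⟨C, hlen, hwf, Set.forall_mem_insert.2 ⟨⟨n + C.length, le_rfl, fun x => ?_⟩, hval⟩⟩
  rw [add_comm, Circuit.getD_eval, inputWires,
    List.getD_append_right _ _ _ _ (by simp)]
  simp

theorem insert_nand (h : HasCircuit n s S) (hf : f ∈ S) (hg : g ∈ S) :
    HasCircuit n (s + 1) (insert (fun x => !(f x && g x)) S) := by
  obtain ⟨C, hlen, hwf, hval⟩ := h
  obtain ⟨i, hi, hfi⟩ := hval f hf
  obtain ⟨j, hj, hgj⟩ := hval g hg
  refine ⟨C ++ [(i, j)], by simpa using hlen, hwf.concat hi hj,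
    Set.forall_mem_insert.2 ⟨⟨0, Nat.zero_le _, fun x => ?_⟩, fun f' hf' => ?_⟩⟩
  · rw [Circuit.eval_concat, List.getD_cons_zero, gateValue, hfi, hgj]
  · obtain ⟨l, hl, hfl⟩ := hval f' hf'
    refine ⟨l + 1, by rw [List.length_append]; exact Nat.succ_le_succ hl, fun x => ?_⟩
    rw [Circuit.eval_concat, List.getD_cons_succ, hfl]

theorem insert_formula (h : HasCircuit n s S) (hf : Formula S k f) :
    HasCircuit n (s + k) (insert f S) := by
  -- The subformulas are added one after the other, so the induction is over all supersets of `S`.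
  suffices H : ∀ (T : Set ((Fin n → Bool) → Bool)) (s : ℕ), S ⊆ T → HasCircuit n s T →
      HasCircuit n (s + k) (insert f T) from H S s subset_rfl h
  clear h
  induction hf with
  | base h =>
    intro T s hT hs
    rw [Set.insert_eq_of_mem (hT h)]
    exact hs.mono (Nat.le_add_right _ _)
  | top => exact fun T s _ hs => hs.insert_true.mono (Nat.le_add_right _ _)
  | @nand a b k f g _ _ hk ihf ihg =>
    intro T s hT hs
    have hfg : HasCircuit n (s + a + b) (insert g (insert f T)) :=
      ihg _ _ (hT.trans (Set.subset_insert _ _)) (ihf T s hT hs)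
    refine ((hfg.insert_nand (f := f) (g := g) (by simp) (by simp)).mono (by omega)).subset ?_
    gcongr
    exact (Set.subset_insert _ _).trans (Set.subset_insert _ _)

theorem union_formulas (h : HasCircuit n s S) (F : List ((Fin n → Bool) → Bool))
    (hF : ∀ f ∈ F, Formula S k f) : HasCircuit n (s + F.length * k) (S ∪ {f | f ∈ F}) := by
  induction F with
  | nil => simpa using h
  | cons f F ih =>
    obtain ⟨hf, hF⟩ := List.forall_mem_cons.1 hF
    refine (((ih hF).insert_formula (hf.subset Set.subset_union_left)).mono ?_).subset ?_
    · rw [List.length_cons, add_mul]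
      omega
    · rintro g (hg | hg)
      · exact .inr (.inl hg)
      · rcases List.mem_cons.1 hg with rfl | hg
        exacts [.inl rfl, .inr (.inr hg)]

theorem exists_head_eval_eq (h : HasCircuit n s S) (hf : f ∈ S) :
    ∃ C : Circuit, C.length ≤ s + 2 ∧ C.WellFormed n ∧
      ∀ x, (C.eval (inputWires (List.ofFn x))).headD false = f x := by
  obtain ⟨C, hlen, hwf, hval⟩ := h
  obtain ⟨i, hi, hfi⟩ := hval f hf
  refine ⟨C ++ [(i, i)] ++ [(0, 0)], by simpa using hlen,
    (hwf.concat hi hi).concat (Nat.zero_le _) (Nat.zero_le _), fun x => ?_⟩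
  rw [Circuit.eval_concat, Circuit.eval_concat, List.headD_cons]
  simp only [gateValue, List.getD_cons_zero, hfi, Bool.and_self, Bool.not_not]

end HasCircuit

/-! ### Circuits of polynomial size and P/poly -/

/-- `f` is bounded by a polynomial. -/
def PolyBounded (f : ℕ → ℕ) : Prop := ∃ p : Polynomial ℕ, ∀ n, f n ≤ p.eval n

namespace PolyBounded

variable {f g : ℕ → ℕ}

theorem eval (p : Polynomial ℕ) : PolyBounded fun n => p.eval n := ⟨p, fun _ => le_rfl⟩

theorem const (c : ℕ) : PolyBounded fun _ => c := ⟨Polynomial.C c, by simp⟩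

theorem id : PolyBounded fun n => n := ⟨Polynomial.X, by simp⟩

theorem add (hf : PolyBounded f) (hg : PolyBounded g) : PolyBounded fun n => f n + g n := by
  obtain ⟨p, hp⟩ := hf
  obtain ⟨q, hq⟩ := hg
  exact ⟨p + q, fun n => by simpa using Nat.add_le_add (hp n) (hq n)⟩

theorem mul (hf : PolyBounded f) (hg : PolyBounded g) : PolyBounded fun n => f n * g n := by
  obtain ⟨p, hp⟩ := hf
  obtain ⟨q, hq⟩ := hg
  exact ⟨p * q, fun n => by simpa using Nat.mul_le_mul (hp n) (hq n)⟩

theorem mono (hf : PolyBounded f) (h : ∀ n, g n ≤ f n) : PolyBounded g := by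
  obtain ⟨p, hp⟩ := hf
  exact ⟨p, fun n => (h n).trans (hp n)⟩

theorem comp (hf : PolyBounded f) (p : Polynomial ℕ) : PolyBounded fun n => f (p.eval n) := by
  obtain ⟨q, hq⟩ := hf
  exact ⟨q.comp p, fun n => by simpa using hq (p.eval n)⟩

end PolyBounded

namespace Evaluator

/-- The stacks of a machine that evaluates circuits: the input, the code of a circuit, and the
wires to the left and to the right of a cursor. -/
inductive Stack
  | inp | prog | lft | rgt
  deriving DecidableEq

instance : Fintype Stack :=
  ⟨{.inp, .prog, .lft, .rgt}, fun k => by cases k <;> simp⟩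

/-- The stack alphabets. -/
@[reducible] def Alphabet : Stack → Type
  | .inp => Option Bool
  | _ => Bool

/-- The phases of the evaluation: reading the code, reading the input bits, executing the code, and
emptying the stacks. -/
inductive Label
  | advice | input | exec | clear
  deriving DecidableEq

instance : Fintype Label :=
  ⟨{.advice, .input, .exec, .clear}, fun k => by cases k <;> simp⟩

/-- The registers of the evaluator: the symbols popped in the current step, and the two wires `r₀`
(more recent) and `r₁` loaded last. -/
structure Reg where
  sym : Option (Option Bool)
  b₁ : Option Bool
  b₂ : Option Bool
  wire : Option Bool
  r₀ : Bool
  r₁ : Bool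
  deriving Fintype

/-- The registers between two steps. -/
def reg (r₀ r₁ : Bool) : Reg := ⟨none, none, none, none, r₀, r₁⟩

open TM2.Stmt

/-- The end of every step: empty the scratch registers and go to `l`. -/
def jump (l : Label) : TM2.Stmt Alphabet Label Reg :=
  load (fun s => reg s.r₀ s.r₁) <| goto fun _ => l

/-- The program of the evaluator. The code consists of two-bit instructions: `00` and `01` move the
cursor to the right and to the left, `10` loads the wire under the cursor, and `11` pushes the NAND
of the two wires loaded last. -/
def program : Label → TM2.Stmt Alphabet Label Reg
  | .advice =>
    pop .inp (fun s a => { s with sym := a }) <|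
    branch (fun s => s.sym == some none)
      (push .rgt (fun _ => true) <| jump .input)
      (push .prog (fun s => s.sym.join.getD false) <| jump .advice)
  | .input =>
    pop .inp (fun s a => { s with sym := a }) <|
    branch (fun s => s.sym.isSome)
      (push .rgt (fun s => s.sym.join.getD false) <| jump .input)
      (jump .exec)
  | .exec =>
    pop .prog (fun s a => { s with b₁ := a }) <|
    pop .prog (fun s a => { s with b₂ := a }) <|
    branch (fun s => s.b₁.isNone)
      (pop .rgt (fun s a => { s with r₀ := a.getD false }) <| jump .clear) <|
    branch (fun s => s.b₁ == some false)
      (branch (fun s => s.b₂ == some false)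
        (pop .rgt (fun s a => { s with wire := a }) <|
         branch (fun s => s.wire.isSome)
          (push .lft (fun s => s.wire.getD false) <| jump .exec)
          (jump .exec))
        (pop .lft (fun s a => { s with wire := a }) <|
         branch (fun s => s.wire.isSome)
          (push .rgt (fun s => s.wire.getD false) <| jump .exec)
          (jump .exec)))
      (branch (fun s => s.b₂ == some false)
        (peek .rgt (fun s a => { s with r₀ := a.getD false, r₁ := s.r₀ }) <| jump .exec)
        (push .rgt (fun s => !(s.r₁ && s.r₀)) <| jump .exec))
  | .clear =>
    pop .rgt (fun s a => { s with wire := a }) <|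
    branch (fun s => s.wire.isSome)
      (jump .clear)
      (push .lft (fun s => s.r₀) <| load (fun _ => reg false false) halt)

/-- The evaluator, a machine that evaluates a circuit, given by its code, on an input. -/
def machine : TM2ComputableAux (Option Bool) Bool where
  tm :=
    { K := Stack
      k₀ := .inp
      k₁ := .lft
      Γ := Alphabet
      Λ := Label
      main := .advice
      σ := Reg
      initialState := reg false false
      Γk₀Fin := inferInstanceAs (Fintype (Option Bool))
      m := program }
  inputAlphabet := Equiv.refl _
  outputAlphabet := Equiv.refl _

/-- The contents of the stacks. -/
def store (a : List (Option Bool)) (p l r : List Bool) : ∀ k, List (Alphabet k)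
  | .inp => a
  | .prog => p
  | .lft => l
  | .rgt => r

/-- The running configurations between two steps. -/
def cfg (lab : Label) (r₀ r₁ : Bool) (a : List (Option Bool)) (p l r : List Bool) :
    TM2.Cfg Alphabet Label Reg :=
  ⟨some lab, reg r₀ r₁, store a p l r⟩

section Store

variable (a a' : List (Option Bool)) (p p' l l' r r' : List Bool)

@[simp] theorem store_inp : store a p l r .inp = a := rfl

@[simp] theorem store_prog : store a p l r .prog = p := rfl

@[simp] theorem store_lft : store a p l r .lft = l := rfl

@[simp] theorem store_rgt : store a p l r .rgt = r := rfl

@[simp] theorem update_inp : Function.update (store a p l r) .inp a' = store a' p l r := by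
  funext k
  cases k <;> rfl

@[simp] theorem update_prog : Function.update (store a p l r) .prog p' = store a p' l r := by
  funext k
  cases k <;> rfl

@[simp] theorem update_lft : Function.update (store a p l r) .lft l' = store a p l' r := by
  funext k
  cases k <;> rfl

@[simp] theorem update_rgt : Function.update (store a p l r) .rgt r' = store a p l r' := by
  funext k
  cases k <;> rfl

end Store

section Runs

variable (p l r : List Bool) (r₀ r₁ : Bool)

theorem reach_advice (v : List (Option Bool)) (w : List Bool) :
    ReachesWithin (TM2.step program) (cfg .advice r₀ r₁ (w.map some ++ none :: v) p l r)
      (w.length + 1) (cfg .input r₀ r₁ v (w.reverse ++ p) l (true :: r)) := by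
  induction w generalizing p with
  | nil => exact .single (by simp [cfg, program, jump, reg])
  | cons b w ih =>
    refine .head (b := cfg .advice r₀ r₁ (w.map some ++ none :: v) (b :: p) l r) ?_ ?_
    · simp [cfg, program, jump, reg]
    · simpa using ih (b :: p)

theorem reach_input (x : List Bool) :
    ReachesWithin (TM2.step program) (cfg .input r₀ r₁ (x.map some) p l r) (x.length + 1)
      (cfg .exec r₀ r₁ [] p l (x.reverse ++ r)) := by
  induction x generalizing r with
  | nil => exact .single (by simp [cfg, program, jump, reg])
  | cons b w ih =>
    refine .head (b := cfg .input r₀ r₁ (w.map some) p l (b :: r)) ?_ ?_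
    · simp [cfg, program, jump, reg]
    · simpa using ih (b :: r)

theorem reach_clear :
    ReachesWithin (TM2.step program) (cfg .clear r₀ r₁ [] [] [] r) (r.length + 1)
      ⟨none, reg false false, store [] [] [r₀] []⟩ := by
  induction r with
  | nil => exact .single (by simp [cfg, program, jump, reg])
  | cons b w ih =>
    refine .head (b := cfg .clear r₀ r₁ [] [] [] w) ?_ ih
    simp [cfg, program, jump, reg]

/-- The code that moves the cursor `i` wires to the right. -/
def right (i : ℕ) : List Bool := (List.replicate i [false, false]).flatten

/-- The code that moves the cursor `i` wires to the left. -/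
def left (i : ℕ) : List Bool := (List.replicate i [false, true]).flatten

theorem reach_right (i : ℕ) :
    ReachesWithin (TM2.step program) (cfg .exec r₀ r₁ [] (right i ++ p) l r) i
      (cfg .exec r₀ r₁ [] p ((r.take i).reverse ++ l) (r.drop i)) := by
  induction i generalizing l r with
  | zero => exact .refl _
  | succ i ih =>
    cases r with
    | nil =>
      refine .head ?_ (by simpa using ih l [])
      simp [cfg, program, jump, reg, right, List.replicate_succ]
    | cons b r =>
      refine .head ?_ (by simpa using ih (b :: l) r)
      simp [cfg, program, jump, reg, right, List.replicate_succ]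

theorem reach_left (i : ℕ) :
    ReachesWithin (TM2.step program) (cfg .exec r₀ r₁ [] (left i ++ p) l r) i
      (cfg .exec r₀ r₁ [] p (l.drop i) ((l.take i).reverse ++ r)) := by
  induction i generalizing l r with
  | zero => exact .refl _
  | succ i ih =>
    cases l with
    | nil =>
      refine .head ?_ (by simpa using ih [] r)
      simp [cfg, program, jump, reg, left, List.replicate_succ]
    | cons b l =>
      refine .head ?_ (by simpa using ih l (b :: r))
      simp [cfg, program, jump, reg, left, List.replicate_succ]

/-- The code that loads the `i`-th wire into a register. -/
def fetch (i : ℕ) : List Bool := right i ++ ([true, false] ++ left i)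

theorem reach_fetch (i : ℕ) :
    ReachesWithin (TM2.step program) (cfg .exec r₀ r₁ [] (fetch i ++ p) [] r) (2 * i + 1)
      (cfg .exec (r.getD i false) r₀ [] p [] r) := by
  have hright := reach_right ([true, false] ++ left i ++ p) [] r r₀ r₁ i
  have hload : ReachesWithin (TM2.step program)
      (cfg .exec r₀ r₁ [] ([true, false] ++ left i ++ p) ((r.take i).reverse ++ []) (r.drop i)) 1
      (cfg .exec (r.getD i false) r₀ [] (left i ++ p) ((r.take i).reverse ++ []) (r.drop i)) :=
    .single (by simp [cfg, program, jump, reg, List.head?_drop])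
  have hleft := reach_left p ((r.take i).reverse ++ []) (r.drop i) (r.getD i false) r₀ i
  have hdrop : ((r.take i).reverse ++ []).drop i = [] := by simp
  have htake : (((r.take i).reverse ++ []).take i).reverse ++ r.drop i = r := by
    rw [List.append_nil, List.take_of_length_le (by simp), List.reverse_reverse,
      List.take_append_drop]
  rw [hdrop, htake] at hleft
  have hrun := (hright.trans hload).trans hleft
  simp only [fetch, List.append_assoc] at hrun ⊢
  exact hrun.mono (by omega)

/-- The code of a gate. -/
def gateCode (g : ℕ × ℕ) : List Bool := fetch g.1 ++ (fetch g.2 ++ [true, true])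

/-- The code of a circuit. -/
def code (C : Circuit) : List Bool := C.flatMap gateCode

theorem length_gateCode (g : ℕ × ℕ) : (gateCode g).length = 4 * g.1 + 4 * g.2 + 6 := by
  simp only [gateCode, fetch, right, left, List.length_append, List.length_flatten,
    List.map_replicate, List.sum_replicate, List.length_cons, List.length_nil, smul_eq_mul]
  ring

theorem reach_gateCode (g : ℕ × ℕ) :
    ReachesWithin (TM2.step program) (cfg .exec r₀ r₁ [] (gateCode g ++ p) [] r)
      (gateCode g).length
      (cfg .exec (r.getD g.2 false) (r.getD g.1 false) [] p [] (gateValue r g :: r)) := by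
  have hfst := reach_fetch (fetch g.2 ++ ([true, true] ++ p)) r r₀ r₁ g.1
  have hsnd := reach_fetch ([true, true] ++ p) r (r.getD g.1 false) r₀ g.2
  have hnand : ReachesWithin (TM2.step program)
      (cfg .exec (r.getD g.2 false) (r.getD g.1 false) [] ([true, true] ++ p) [] r) 1
      (cfg .exec (r.getD g.2 false) (r.getD g.1 false) [] p [] (gateValue r g :: r)) :=
    .single (by simp [cfg, program, jump, reg, gateValue])
  have hrun := (hfst.trans hsnd).trans hnand
  rw [length_gateCode]
  simp only [gateCode, List.append_assoc] at hrun ⊢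
  exact hrun.mono (by omega)

theorem reach_code (C : Circuit) :
    ∃ r₀' r₁', ReachesWithin (TM2.step program) (cfg .exec r₀ r₁ [] (code C) [] r)
      (code C).length (cfg .exec r₀' r₁' [] [] [] (C.eval r)) := by
  induction C generalizing r r₀ r₁ with
  | nil => exact ⟨_, _, .refl _⟩
  | cons g C ih =>
    obtain ⟨r₀', r₁', h⟩ := ih (gateValue r g :: r) (r.getD g.2 false) (r.getD g.1 false)
    rw [Circuit.eval_cons, code, List.flatMap_cons, List.length_append]
    exact ⟨r₀', r₁', (reach_gateCode _ r r₀ r₁ g).trans h⟩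

end Runs

theorem length_code_le {C : Circuit} {n : ℕ} (hC : C.WellFormed n) :
    (code C).length ≤ C.length * (8 * (n + C.length) + 6) := by
  rw [code, List.length_flatMap]
  refine (List.sum_le_card_nsmul _ (8 * (n + C.length) + 6) ?_).trans_eq (by simp)
  simp only [List.mem_map, forall_exists_index, and_imp, forall_apply_eq_imp_iff₂]
  intro g hg
  have := hC g hg
  rw [length_gateCode]
  omega

theorem computes (C : Circuit) (x : List Bool) :
    Computes machine (pairEnc (code C).reverse x) [(C.eval (inputWires x)).headD false]
      (2 * (code C).length + 2 * x.length + C.length + 6) := by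
  set ws := C.eval (inputWires x) with hws
  have hinit : initList machine.tm ((pairEnc (code C).reverse x).map machine.inputAlphabet.symm) =
      cfg .advice false false (pairEnc (code C).reverse x) [] [] [] :=
    initList_eq (List.map_id _).symm <| by
      rintro (_ | _ | _ | _) hk <;> first | rfl | exact (hk rfl).elim
  have hhalt : haltList machine.tm ([ws.headD false].map machine.outputAlphabet.symm) =
      ⟨none, reg false false, store [] [] [ws.headD false] []⟩ :=
    haltList_eq rfl <| by
      rintro (_ | _ | _ | _) hk <;> first | rfl | exact (hk rfl).elim
  rw [computes_iff, hinit, hhalt]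
  have hadvice := reach_advice [] [] [] false false (x.map some) (code C).reverse
  have hinput := reach_input (code C) [] [true] false false x
  rw [List.reverse_reverse, List.append_nil] at hadvice
  obtain ⟨r₀, r₁, hcode⟩ := reach_code (inputWires x) false false C
  have hpop : ReachesWithin (TM2.step program) (cfg .exec r₀ r₁ [] [] [] ws) 1
      (cfg .clear (ws.headD false) r₁ [] [] [] ws.tail) :=
    .single (by simp [cfg, program, jump, reg])
  have hclear := reach_clear ws.tail (ws.headD false) r₁
  refine ((((hadvice.trans hinput).trans hcode).trans hpop).trans hclear).mono ?_
  rw [List.length_reverse, List.length_tail, hws, Circuit.length_eval, length_inputWires]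
  omega

end Evaluator

open Classical in
theorem mem_PPoly_of_hasCircuit {L : Language Bool} {s : ℕ → ℕ} (hs : PolyBounded s)
    (h : ∀ n, HasCircuit n (s n) {fun x => decide (List.ofFn x ∈ L)}) : L ∈ PPoly := by
  choose C hlen hwf hval using fun n => (h n).exists_head_eval_eq rfl
  have hClen : PolyBounded fun n => (C n).length := (hs.add (.const 2)).mono hlen
  obtain ⟨p, hp⟩ : PolyBounded fun n => (Evaluator.code (C n)).length :=
    (hClen.mul (((PolyBounded.const 8).mul (PolyBounded.id.add hClen)).add (.const 6))).mono
      fun n => Evaluator.length_code_le (hwf n)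
  obtain ⟨t, ht⟩ : PolyBounded fun n => 2 * (Evaluator.code (C n)).length + 2 * n +
      (C n).length + 6 :=
    ((((PolyBounded.const 2).mul ⟨p, hp⟩).add ((PolyBounded.const 2).mul .id)).add hClen).add
      (.const 6)
  refine ⟨Evaluator.machine, fun n => (Evaluator.code (C n)).reverse, p, t,
    fun n => by simpa using hp n, fun x => ?_⟩
  have hx : ((C x.length).eval (inputWires x)).headD false = decide (x ∈ L) := by
    simpa using hval x.length x.get
  exact hx ▸ (Evaluator.computes (C x.length) x).mono (ht x.length)

/-! ### Circuits for runs of a probabilistic machine -/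

/-- The configuration that results from an action. -/
def Action.apply (a : Action) (s : PTM.Cfg) : PTM.Cfg :=
  ⟨a.next, (s.tape.write a.write).move a.dir⟩

namespace PTM

/-- The property of a configuration that the machine is in state `q`. -/
def stateBit (q : ℕ) (s : Cfg) : Bool := s.state == q

/-- The property of a configuration that the cell at position `i` relative to the head
contains `b`. -/
def cellBit (i : ℤ) (b : ℕ) (s : Cfg) : Bool := s.tape.nth i == b

/-- The tape symbols that a circuit for `c` has to distinguish. All others behave like each
other. -/
def symbols (c : PTM) : List ℕ := c.rules.map Rule.read ++ [0, 1, 2, 3]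

/-- The Boolean features by which a circuit represents a configuration of `c`: the state, as far as
it occurs in a rule, and the relevant symbols in the cells at distance at most `W` from the head. -/
def features (c : PTM) (W : ℕ) : List (Cfg → Bool) :=
  c.rules.map (fun r => stateBit r.state) ++
    (List.range (2 * W + 1)).flatMap fun i : ℕ => c.symbols.map (cellBit ((i : ℤ) - W))

theorem length_features (c : PTM) (W : ℕ) :
    (c.features W).length = c.rules.length + (2 * W + 1) * (c.rules.length + 4) := by
  simp [features, symbols, List.length_flatMap]

theorem mem_features {c : PTM} {W : ℕ} {f : Cfg → Bool} :
    f ∈ c.features W ↔ (∃ r ∈ c.rules, f = stateBit r.state) ∨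
      ∃ i : ℤ, i.natAbs ≤ W ∧ ∃ b ∈ c.symbols, f = cellBit i b := by
  simp only [features, List.mem_append, List.mem_map, List.mem_flatMap, List.mem_range]
  refine or_congr (by simp only [eq_comm]) ⟨?_, ?_⟩
  · rintro ⟨i, hi, b, hb, rfl⟩
    exact ⟨(i : ℤ) - W, by omega, b, hb, rfl⟩
  · rintro ⟨i, hi, b, hb, rfl⟩
    exact ⟨(i + W).toNat, by omega, b, hb, by congr 1; omega⟩

theorem stateBit_mem_features {c : PTM} {r : Rule} (hr : r ∈ c.rules) (W : ℕ) :
    stateBit r.state ∈ c.features W :=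
  mem_features.2 (.inl ⟨r, hr, rfl⟩)

theorem cellBit_mem_features {c : PTM} {i : ℤ} {W b : ℕ} (hi : i.natAbs ≤ W) (hb : b ∈ c.symbols) :
    cellBit i b ∈ c.features W :=
  mem_features.2 (.inr ⟨i, hi, b, hb, rfl⟩)

theorem step_eq_elim (c : PTM) (s : Cfg) (b : Bool) :
    c.step s b = (c.ruleAt s).elim s fun r => (if b then r.act₁ else r.act₀).apply s := by
  rw [step]
  cases c.ruleAt s <;> rfl

theorem nth_move_write (d : Dir) (w : ℕ) (i : ℤ) :
    (i.natAbs = 1 ∧ ∀ t : Tape ℕ, ((t.write w).move d).nth i = w) ∨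
      ∃ j : ℤ, (i - j).natAbs = 1 ∧ ∀ t : Tape ℕ, ((t.write w).move d).nth i = t.nth j := by
  cases d with
  | left =>
    by_cases hi : i = 1
    · exact .inl ⟨by simp [hi], fun t => by simp [hi, Tape.write]⟩
    · exact .inr ⟨i - 1, by simp, fun t => by simp [sub_eq_zero, hi]⟩
  | right =>
    by_cases hi : i = -1
    · exact .inl ⟨by simp [hi], fun t => by simp [hi, Tape.write]⟩
    · exact .inr ⟨i + 1, by simp, fun t => by simp [add_eq_zero_iff_eq_neg, hi]⟩

theorem formula_matches {c : PTM} {r : Rule} (hr : r ∈ c.rules) (W : ℕ) :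
    Formula {g | g ∈ c.features W} 2 fun s => r.state == s.state && r.read == s.tape.head := by
  have hread : r.read ∈ c.symbols := List.mem_append_left _ (List.mem_map_of_mem hr)
  have hstate : Formula {g | g ∈ c.features W} 0 (stateBit r.state) :=
    .base (stateBit_mem_features hr W)
  have hcell : Formula {g | g ∈ c.features W} 0 (cellBit 0 r.read) :=
    .base (cellBit_mem_features (by simp) hread)
  convert hstate.and hcell using 3 with s
  · exact BEq.comm
  · rw [cellBit, Tape.nth_zero, BEq.comm]

theorem formula_apply {c : PTM} {W : ℕ} {f : Cfg → Bool} (hf : f ∈ c.features W) (a : Action) :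
    Formula {g | g ∈ c.features (W + 1)} 1 fun s => f (a.apply s) := by
  rcases mem_features.1 hf with ⟨r, -, rfl⟩ | ⟨i, hi, b, hb, rfl⟩
  · exact .const (a.next == r.state)
  · rcases nth_move_write a.dir a.write i with ⟨-, hw⟩ | ⟨j, hj, hw⟩
    · simp only [cellBit, Action.apply, hw]
      exact .const _
    · simp only [cellBit, Action.apply, hw]
      exact .base (cellBit_mem_features (by omega) hb)

theorem formula_step {c : PTM} {W : ℕ} {f : Cfg → Bool} (hf : f ∈ c.features W) (b : Bool) :
    Formula {g | g ∈ c.features (W + 1)} (c.rules.length * 13 + 1) fun s => f (c.step s b) := by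
  have hstay : Formula {g | g ∈ c.features (W + 1)} 1 f := by
    rcases mem_features.1 hf with ⟨r, hr, rfl⟩ | ⟨i, hi, b, hb, rfl⟩
    · exact .base (stateBit_mem_features hr _)
    · exact .base (cellBit_mem_features (by omega) hb)
  convert Formula.elim_find? c.rules (fun r hr => formula_matches hr (W + 1))
    (fun r _ => formula_apply hf (if b then r.act₁ else r.act₀)) hstay using 2 with s
  rw [step_eq_elim, ruleAt]
  cases c.rules.find? _ <;> rfl

/-- A bound for the number of gates by which the features of radius `W` after a step are computed
from the features of radius `W + 1` before it. -/
def stepSize (c : PTM) (W : ℕ) : ℕ := (c.features W).length * (c.rules.length * 13 + 1)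

theorem stepSize_mono (c : PTM) : Monotone c.stepSize := fun V W h => by
  simp only [stepSize, length_features]
  gcongr

theorem hasCircuit_run {n s : ℕ} {S : Set ((Fin n → Bool) → Bool)} (h : HasCircuit n s S)
    (c : PTM) (W : ℕ) (cs : List Bool) (cfg : (Fin n → Bool) → Cfg)
    (hS : (· ∘ cfg) '' {g | g ∈ c.features (W + cs.length)} ⊆ S) :
    HasCircuit n (s + cs.length * c.stepSize (W + cs.length))
      (S ∪ (· ∘ fun x => cs.foldl c.step (cfg x)) '' {g | g ∈ c.features W}) := by
  induction cs generalizing s S cfg with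
  | nil => simpa using h.subset (by simpa using hS)
  | cons b cs ih =>
    have hstep := h.union_formulas
      ((c.features (W + cs.length)).map (· ∘ fun x => c.step (cfg x) b)) (by
        simp only [List.mem_map, forall_exists_index, and_imp, forall_apply_eq_imp_iff₂]
        exact fun f hf => ((formula_step hf b).comp cfg).subset hS)
    have hrun := ih hstep (fun x => c.step (cfg x) b) <| by
      rintro _ ⟨g, hg, rfl⟩
      exact .inr (List.mem_map.2 ⟨g, hg, rfl⟩)
    refine (hrun.mono ?_).subset (Set.union_subset_union_left _ Set.subset_union_left)
    rw [List.length_map, List.length_cons]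
    have hmono := c.stepSize_mono (Nat.le_succ (W + cs.length))
    calc s + c.stepSize (W + cs.length) + cs.length * c.stepSize (W + cs.length)
      _ = s + (cs.length + 1) * c.stepSize (W + cs.length) := by ring
      _ ≤ s + (cs.length + 1) * c.stepSize (W + (cs.length + 1)) := by gcongr; omega

theorem nth_mk₁ {Γ : Type*} [Inhabited Γ] (l : List Γ) (i : ℤ) :
    (Tape.mk₁ l).nth i = if i < 0 then default else l.getI i.toNat := by
  rcases i with k | k
  · simp [Tape.mk₁, Tape.mk₂, ListBlank.nth_mk]
  · rw [if_pos (Int.negSucc_lt_zero k)]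
    change (ListBlank.mk ([] : List Γ)).nth k = default
    rw [ListBlank.nth_mk, List.getI_nil]

theorem formula_init {X : Type*} {S : Set (X → Bool)} {inp : X → List (Option Bool)}
    (hinp : ∀ j : ℕ, (∃ o, ∀ x, (inp x)[j]? = o) ∨ ∃ g ∈ S, ∀ x, (inp x)[j]? = some (some (g x)))
    {c : PTM} {W : ℕ} {f : Cfg → Bool} (hf : f ∈ c.features W) :
    Formula S 1 fun x => f (init (inp x)) := by
  rcases mem_features.1 hf with ⟨r, -, rfl⟩ | ⟨i, -, b, -, rfl⟩
  · exact .const (0 == r.state)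
  simp only [cellBit, init, nth_mk₁, List.getI_eq_getElem?_getD, List.getElem?_map]
  by_cases hi : i < 0
  · simp only [hi, if_true]
    exact .const _
  simp only [hi, if_false]
  rcases hinp i.toNat with ⟨o, ho⟩ | ⟨g, hg, hgi⟩
  · simp only [ho]
    exact .const _
  · simp only [hgi]
    exact (Formula.base (k := 0) hg).bool_comp fun y => symbol (some y) == b

end PTM

/-! ### A circuit that estimates the output -/

theorem binValue_cons (b : Bool) (l : List Bool) : binValue (b :: l) = Nat.bit b (binValue l) := by
  rw [binValue, List.map_cons, Nat.ofDigits_cons, Nat.bit_val, add_comm]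
  rfl

theorem testBit_binValue (l : List Bool) (i : ℕ) :
    (binValue l).testBit i = true ↔ l[i]? = some true := by
  induction l generalizing i with
  | nil => simp [binValue]
  | cons b l ih =>
    rw [binValue_cons]
    cases i with
    | zero => rw [Nat.testBit_bit_zero, List.getElem?_cons_zero, Option.some_inj]
    | succ i => rw [Nat.testBit_bit_succ, List.getElem?_cons_succ, ih]

theorem exists_testBit_of_le_mul {a b j : ℕ} (hb : b ≠ 0) (h : b ≤ a * 2 ^ j) :
    ∃ i, a.testBit i = true ∧ ∀ k, i + j < k → b.testBit k = false := by
  have ha : a ≠ 0 := by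
    rintro rfl
    exact hb (by simpa using h)
  obtain ⟨i, hi, htop⟩ := Nat.exists_most_significant_bit ha
  refine ⟨i, hi, fun k hk => Nat.testBit_lt_two_pow ?_⟩
  have ha' : a < 2 ^ (i + 1) :=
    Nat.lt_pow_two_of_testBit a fun l hl => htop l (Nat.lt_of_succ_le hl)
  calc b ≤ a * 2 ^ j := h
    _ < 2 ^ (i + 1) * 2 ^ j := by gcongr
    _ = 2 ^ (i + j + 1) := by ring
    _ ≤ 2 ^ k := Nat.pow_le_pow_right two_pos hk

theorem lt_mul_of_testBit {a b i j : ℕ} (ha : a.testBit i = true)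
    (hb : ∀ k, i + j < k → b.testBit k = false) : b < a * 2 ^ (j + 1) :=
  calc b < 2 ^ (i + j + 1) := Nat.lt_pow_two_of_testBit b fun k hk => hb k (Nat.lt_of_succ_le hk)
    _ = 2 ^ i * 2 ^ (j + 1) := by ring
    _ ≤ a * 2 ^ (j + 1) := Nat.mul_le_mul_right _ (Nat.ge_two_pow_of_testBit ha)

section PairEnc

variable {u v : List Bool} {i : ℕ}

theorem length_pairEnc (u v : List Bool) : (pairEnc u v).length = u.length + 1 + v.length := by
  simp only [pairEnc, List.length_append, List.length_map, List.length_cons]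
  omega

theorem getElem?_pairEnc_left (hi : i < u.length) : (pairEnc u v)[i]? = u[i]?.map some := by
  rw [pairEnc, List.getElem?_append_left (by simpa using hi), List.getElem?_map]

theorem getElem?_pairEnc_right (u v : List Bool) (i : ℕ) :
    (pairEnc u v)[u.length + 1 + i]? = v[i]?.map some := by
  rw [pairEnc, List.getElem?_append_right (by simp only [List.length_map]; omega), List.length_map,
    show u.length + 1 + i - u.length = i + 1 by omega, List.getElem?_cons_succ, List.getElem?_map]

theorem getElem?_pairEnc_eq_none_iff : (pairEnc u v)[i]? = some none ↔ i = u.length := by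
  rcases lt_trichotomy i u.length with hi | rfl | hi
  · simp [getElem?_pairEnc_left hi, hi.ne]
  · simp [pairEnc]
  · obtain ⟨k, rfl⟩ := Nat.exists_eq_add_of_lt hi
    rw [add_right_comm, getElem?_pairEnc_right]
    simp only [Option.map_eq_some_iff, reduceCtorEq, and_false, exists_false, false_iff]
    omega

end PairEnc

namespace PTM

theorem nth_foldl_step (c : PTM) (cs : List Bool) {B : ℕ} {s : Cfg}
    (h : ∀ i : ℤ, B < i.natAbs → s.tape.nth i = 0) {i : ℤ} (hi : B + cs.length < i.natAbs) :
    (cs.foldl c.step s).tape.nth i = 0 := by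
  induction cs generalizing s B with
  | nil => exact h i hi
  | cons b cs ih =>
    rw [List.length_cons] at hi
    refine ih (B := B + 1) (fun i hi => ?_) (by omega)
    rw [step_eq_elim]
    cases c.ruleAt s with
    | none => exact h i (by omega)
    | some r =>
      rcases nth_move_write (if b then r.act₁ else r.act₀).dir
        (if b then r.act₁ else r.act₀).write i with ⟨hi', -⟩ | ⟨j, hj, hnth⟩
      · omega
      · exact (hnth s.tape).trans (h j (by omega))

theorem nth_init (inp : List (Option Bool)) (i : ℤ) (hi : inp.length < i.natAbs) :
    (init inp).tape.nth i = 0 := by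
  rw [init, nth_mk₁]
  split_ifs with h
  · rfl
  · exact List.getI_eq_default _ (by rw [List.length_map]; omega)

theorem symbol_ne_zero (o : Option Bool) : symbol o ≠ 0 := by
  rcases o with _ | _ | _ <;> simp [symbol]

theorem symbol_injective : Function.Injective symbol := by
  rintro (_ | _ | _) (_ | _ | _) h <;> first | rfl | cases h

section Outputs

variable {s : Cfg} {out : List (Option Bool)}

theorem nth_eq_symbol_iff (h : s.tape.right₀ = ListBlank.mk (out.map symbol)) (i : ℕ)
    (o : Option Bool) : s.tape.nth i = symbol o ↔ out[i]? = some o := by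
  rw [← Tape.right₀_nth, h, ListBlank.nth_mk, List.getI_eq_getElem?_getD, List.getElem?_map]
  rcases out[i]? with _ | x
  · exact ⟨fun h => (symbol_ne_zero o h.symm).elim, fun h => nomatch h⟩
  · exact symbol_injective.eq_iff.trans Option.some_inj.symm

theorem length_output_le {c : PTM} {cs : List Bool} {inp : List (Option Bool)}
    (h : (cs.foldl c.step (init inp)).tape.right₀ = ListBlank.mk (out.map symbol)) :
    out.length ≤ inp.length + cs.length + 1 := by
  by_contra! hlt
  have hblank : (cs.foldl c.step (init inp)).tape.nth (inp.length + cs.length + 1 : ℕ) = 0 :=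
    nth_foldl_step c cs (nth_init inp) (by rw [Int.natAbs_natCast]; omega)
  rw [(nth_eq_symbol_iff h _ _).2 (List.getElem?_eq_getElem hlt)] at hblank
  exact symbol_ne_zero _ hblank

/-- If the tape from the head to the right reads `u#v`, where `#` is in the first `W` cells, this
says that the binary number `v` is at most `j` digits longer than `u`, so that `u / v` is at least
`2⁻ʲ`, up to a factor of `2`. In contrast to `u / v ≥ 2⁻ʲ` itself, this takes no arithmetic to
check. -/
def largeOutput (W j : ℕ) (s : Cfg) : Bool :=
  (List.range W).any fun p => (List.range W).any fun i =>
    (decide (i < p) && (cellBit p 3 s && cellBit i 2 s)) &&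
      (List.range W).all fun k => decide (k ≤ p + 1 + i + j) || !cellBit k 2 s

variable {W j : ℕ} {r : ℚ}

theorem largeOutput_iff {u v : List Bool}
    (h : s.tape.right₀ = ListBlank.mk ((pairEnc u v).map symbol))
    (hW : (pairEnc u v).length ≤ W) :
    largeOutput W j s = true ↔
      ∃ i, (binValue u).testBit i = true ∧ ∀ k, i + j < k → (binValue v).testBit k = false := by
  rw [length_pairEnc] at hW
  have hsep (p : ℕ) : cellBit p 3 s = true ↔ p = u.length := by
    rw [cellBit, beq_iff_eq, show 3 = symbol none from rfl, nth_eq_symbol_iff h,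
      getElem?_pairEnc_eq_none_iff]
  have hu (i : ℕ) (hi : i < u.length) : cellBit i 2 s = true ↔ u[i]? = some true := by
    rw [cellBit, beq_iff_eq, show 2 = symbol (some true) from rfl, nth_eq_symbol_iff h,
      getElem?_pairEnc_left hi, Option.map_eq_some_iff]
    simp
  have hv (k : ℕ) : cellBit (u.length + 1 + k : ℕ) 2 s = true ↔ v[k]? = some true := by
    rw [cellBit, beq_iff_eq, show 2 = symbol (some true) from rfl, nth_eq_symbol_iff h,
      getElem?_pairEnc_right, Option.map_eq_some_iff]
    simp
  simp only [largeOutput, List.any_eq_true, List.mem_range, Bool.and_eq_true, decide_eq_true_eq,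
    List.all_eq_true, Bool.or_eq_true, Bool.not_eq_true', hsep, ← Bool.not_eq_true,
    testBit_binValue]
  constructor
  · rintro ⟨p, -, i, -, ⟨hip, rfl, hi⟩, hall⟩
    refine ⟨i, (hu i hip).1 hi, fun k hk hvk => ?_⟩
    have hkv : k < v.length := (List.getElem?_eq_some_iff.1 hvk).1
    rcases hall (u.length + 1 + k) (by omega) with hle | hcell
    · omega
    · exact hcell ((hv k).2 hvk)
  · rintro ⟨i, hi, hvk⟩
    have hiu : i < u.length := (List.getElem?_eq_some_iff.1 hi).1
    refine ⟨u.length, by omega, i, by omega, ⟨hiu, rfl, (hu i hiu).2 hi⟩, fun k _ => ?_⟩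
    refine or_iff_not_imp_left.2 fun hle hcell => ?_
    obtain ⟨k, rfl⟩ : ∃ l, k = u.length + 1 + l := ⟨k - (u.length + 1), by omega⟩
    exact hvk k (by omega) ((hv k).1 hcell)

theorem largeOutput_of_one_le (h : s.tape.right₀ = ListBlank.mk (out.map symbol))
    (hr : RepresentsRat out r) (hW : out.length ≤ W) (hj : 1 ≤ r * 2 ^ j) :
    largeOutput W j s = true := by
  obtain ⟨u, v, rfl, hv, rfl⟩ := hr
  refine (largeOutput_iff h hW).2 (exists_testBit_of_le_mul hv ?_)
  rw [div_mul_eq_mul_div, le_div_iff₀ (by positivity), one_mul] at hj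
  exact_mod_cast hj

theorem one_lt_of_largeOutput (h : s.tape.right₀ = ListBlank.mk (out.map symbol))
    (hr : RepresentsRat out r) (hW : out.length ≤ W) (hs : largeOutput W j s = true) :
    1 < r * 2 ^ (j + 1) := by
  obtain ⟨u, v, rfl, hv, rfl⟩ := hr
  obtain ⟨i, hi, hk⟩ := (largeOutput_iff h hW).1 hs
  rw [div_mul_eq_mul_div, lt_div_iff₀ (by positivity), one_mul]
  exact_mod_cast lt_mul_of_testBit hi hk

end Outputs

theorem formula_largeOutput (c : PTM) (W j : ℕ) :
    Formula {g | g ∈ c.features W} (W * (W * (9 * W + 12) + 4) + 1) (largeOutput W j) := by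
  have hcell (i : ℕ) (hi : i ∈ List.range W) (b : ℕ) (hb : b ∈ [0, 1, 2, 3]) :
      Formula {g | g ∈ c.features W} 0 (cellBit i b) :=
    .base (cellBit_mem_features (by simpa using (List.mem_range.1 hi).le)
      (List.mem_append_right _ hb))
  refine (Formula.any (k := W * (9 * W + 12) + 1) _ _ fun p hp => ?_).mono (by simp)
  refine (Formula.any (k := 9 * W + 9) _ _ fun i hi => ?_).mono (by simp)
  have hall := Formula.all (List.range W)
    (fun k s => decide (k ≤ p + 1 + i + j) || !cellBit k 2 s)
    fun k hk => (Formula.const _).or (hcell k hk 2 (by simp)).not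
  refine (((Formula.const _).and ((hcell p hp 3 (by simp)).and (hcell i hi 2 (by simp)))).and
    hall).mono ?_
  rw [List.length_range]
  omega

end PTM

/-! ### Derandomization by majority votes over fixed coins -/

section Majority

open Finset

theorem three_mul_sum_ite_le {C : Type*} [Fintype C] {good : C → Prop} [DecidablePred good]
    (h : 2 * Fintype.card C < 3 * #{c | good c}) :
    3 * ∑ c, (if good c then 4 else 9) ≤ 17 * Fintype.card C := by
  have hcard := card_filter_add_card_filter_not (s := (univ : Finset C)) (good ·)
  rw [card_univ] at hcard
  rw [sum_ite, sum_const, sum_const, smul_eq_mul, smul_eq_mul]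
  omega

theorem six_pow_le_prod_ite {ι : Type*} [Fintype ι] {good : ι → Prop} [DecidablePred good]
    (h : 2 * #{i | good i} ≤ Fintype.card ι) :
    6 ^ Fintype.card ι ≤ ∏ i, (if good i then 4 else 9) := by
  have hcard := card_filter_add_card_filter_not (s := (univ : Finset ι)) (good ·)
  rw [card_univ] at hcard
  rw [prod_ite, prod_const, prod_const, ← hcard]
  obtain ⟨d, hd⟩ := Nat.exists_eq_add_of_le (show #{i | good i} ≤ #{i | ¬ good i} by omega)
  rw [hd]
  calc 6 ^ (#{i | good i} + (#{i | good i} + d))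
    _ = (4 * 9) ^ #{i | good i} * 6 ^ d := by
      rw [← add_assoc, pow_add, ← two_mul, pow_mul]
      norm_num
    _ ≤ (4 * 9) ^ #{i | good i} * 9 ^ d := by gcongr; norm_num
    _ = 4 ^ #{i | good i} * 9 ^ (#{i | good i} + d) := by rw [mul_pow, pow_add, mul_assoc]

-- A Chernoff bound: a good value gets the weight `4`, a bad one `9`, so that the average weight is
-- less than `17 / 3`, whereas a tuple without a good majority has weight at least `6 ^ R`.
theorem card_minority_mul_le {C : Type*} [Fintype C] {good : C → Prop} [DecidablePred good]
    (h : 2 * Fintype.card C < 3 * #{c | good c}) (R : ℕ) :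
    #{cs : Fin R → C | 2 * #{i | good (cs i)} ≤ R} * 18 ^ R ≤ 17 ^ R * Fintype.card C ^ R := by
  classical
  have hsix : #{cs : Fin R → C | 2 * #{i | good (cs i)} ≤ R} * 6 ^ R ≤
      (∑ c, if good c then 4 else 9) ^ R := by
    rw [Fintype.sum_pow, ← smul_eq_mul, ← sum_const]
    refine (sum_le_sum fun cs hcs => ?_).trans (sum_le_sum_of_subset (filter_subset _ _))
    simpa using six_pow_le_prod_ite (good := fun i => good (cs i)) (by simpa using hcs)
  calc #{cs : Fin R → C | 2 * #{i | good (cs i)} ≤ R} * 18 ^ R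
    _ = 3 ^ R * (#{cs : Fin R → C | 2 * #{i | good (cs i)} ≤ R} * 6 ^ R) := by
      rw [mul_left_comm, ← mul_pow]; rfl
    _ ≤ 3 ^ R * (∑ c, if good c then 4 else 9) ^ R := by gcongr
    _ = (3 * ∑ c, if good c then 4 else 9) ^ R := (mul_pow _ _ _).symm
    _ ≤ (17 * Fintype.card C) ^ R := Nat.pow_le_pow_left (three_mul_sum_ite_le h) R
    _ = 17 ^ R * Fintype.card C ^ R := mul_pow _ _ _

theorem exists_forall_majority {X C : Type*} [Fintype X] [Fintype C] [Nonempty C]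
    (good : X → C → Prop) [∀ x, DecidablePred (good x)]
    (h : ∀ x, 2 * Fintype.card C < 3 * #{c | good x c}) {R : ℕ}
    (hR : Fintype.card X * 17 ^ R < 18 ^ R) :
    ∃ cs : Fin R → C, ∀ x, R < 2 * #{i | good x (cs i)} := by
  classical
  by_contra! hcon
  have hunion : Fintype.card C ^ R ≤
      ∑ x : X, #{cs : Fin R → C | 2 * #{i | good x (cs i)} ≤ R} := by
    have hcover : (univ : Finset (Fin R → C)) ⊆
        univ.biUnion fun x => {cs | 2 * #{i | good x (cs i)} ≤ R} := fun cs _ => by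
      simpa using hcon cs
    simpa using (card_le_card hcover).trans card_biUnion_le
  have hle : 18 ^ R * Fintype.card C ^ R ≤ Fintype.card X * 17 ^ R * Fintype.card C ^ R := by
    calc 18 ^ R * Fintype.card C ^ R
      _ ≤ 18 ^ R * ∑ x : X, #{cs : Fin R → C | 2 * #{i | good x (cs i)} ≤ R} := by gcongr
      _ = ∑ x : X, #{cs : Fin R → C | 2 * #{i | good x (cs i)} ≤ R} * 18 ^ R := by
        rw [mul_comm, sum_mul]
      _ ≤ ∑ _x : X, 17 ^ R * Fintype.card C ^ R :=
        sum_le_sum fun x _ => card_minority_mul_le (h x) R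
      _ = Fintype.card X * 17 ^ R * Fintype.card C ^ R := by
        rw [sum_const, card_univ, smul_eq_mul, mul_assoc]
  exact hR.not_ge (Nat.le_of_mul_le_mul_right hle (by positivity))

theorem two_pow_mul_seventeen_pow_lt (n : ℕ) :
    2 ^ n * 17 ^ (13 * (n + 1)) < 18 ^ (13 * (n + 1)) := by
  rw [pow_mul, pow_mul]
  calc 2 ^ n * (17 ^ 13) ^ (n + 1)
    _ < 2 ^ (n + 1) * (17 ^ 13) ^ (n + 1) := by gcongr <;> omega
    _ = (2 * 17 ^ 13) ^ (n + 1) := (mul_pow _ _ _).symm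
    _ ≤ (18 ^ 13) ^ (n + 1) := Nat.pow_le_pow_left (by norm_num) _

end Majority

theorem Formula.le_countP_cons {X : Type*} {S : Set (X → Bool)} {J : ℕ} {b : X → Bool}
    {bs : List (X → Bool)} (hb : b ∈ S)
    (hS : ∀ j ≤ J, (fun x => decide (j ≤ bs.countP fun b => b x)) ∈ S) {j : ℕ} (hj : j ≤ J) :
    Formula S 5 fun x => decide (j ≤ (b :: bs).countP fun b => b x) := by
  cases j with
  | zero => simpa using Formula.top
  | succ j =>
    have hj' : Formula S 0 fun x => decide (j ≤ bs.countP fun b => b x) :=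
      .base (hS j (by omega))
    convert ((Formula.base (k := 0) hb).and hj').or (.base (k := 0) (hS (j + 1) hj)) using 2 with x
    rw [List.countP_cons, Bool.eq_iff_iff]
    cases b x
    · simp
    · simp only [if_true, add_le_add_iff_right, decide_eq_true_eq, Bool.true_and, Bool.or_eq_true]
      omega

theorem HasCircuit.threshold {n s : ℕ} {S : Set ((Fin n → Bool) → Bool)} (h : HasCircuit n s S)
    (J : ℕ) {bs : List ((Fin n → Bool) → Bool)} (hbs : ∀ b ∈ bs, b ∈ S) :
    HasCircuit n (s + (bs.length + 1) * ((J + 1) * 5))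
      (S ∪ {f | ∃ j ≤ J, f = fun x => decide (j ≤ bs.countP fun b => b x)}) := by
  induction bs with
  | nil =>
    have hconst := h.union_formulas ((List.range (J + 1)).map fun j _ => decide (j = 0)) (k := 5)
      (by
      simp only [List.mem_map, forall_exists_index, and_imp, forall_apply_eq_imp_iff₂]
      exact fun j _ => (Formula.const _).mono (by omega))
    refine (hconst.mono (by simp)).subset (Set.union_subset_union_right _ ?_)
    rintro _ ⟨j, hj, rfl⟩
    exact List.mem_map.2 ⟨j, List.mem_range.2 (by omega), by simp⟩
  | cons b bs ih =>
    have hcons := (ih fun b hb => hbs b (List.mem_cons_of_mem _ hb)).union_formulas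
      ((List.range (J + 1)).map fun j x => decide (j ≤ (b :: bs).countP fun b => b x)) (k := 5) (by
        simp only [List.mem_map, forall_exists_index, and_imp, forall_apply_eq_imp_iff₂,
          List.mem_range]
        exact fun j hj => .le_countP_cons (.inl (hbs b List.mem_cons_self))
          (fun j hj => .inr ⟨j, hj, rfl⟩) (J := J) (by omega))
    refine (hcons.mono ?_).subset
      (Set.union_subset (fun f hf => .inl (.inl hf)) ?_)
    · rw [List.length_map, List.length_range, List.length_cons]
      exact (by ring : _ = _).le
    · rintro _ ⟨j, hj, rfl⟩
      exact .inr (List.mem_map.2 ⟨j, List.mem_range.2 (by omega), rfl⟩)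

namespace PTM

theorem hasCircuit_runs {n s a T W : ℕ} {S : Set ((Fin n → Bool) → Bool)} {c : PTM}
    {cfg : (Fin n → Bool) → Cfg} {f : Cfg → Bool} (h : HasCircuit n s S)
    (hS : (· ∘ cfg) '' {g | g ∈ c.features (W + T)} ⊆ S)
    (hf : Formula {g | g ∈ c.features W} a f) (cs : List (List Bool))
    (hcs : ∀ l ∈ cs, l.length = T) :
    HasCircuit n (s + cs.length * (T * c.stepSize (W + T) + a))
      (S ∪ {g | g ∈ cs.map fun l x => f (l.foldl c.step (cfg x))}) := by
  induction cs with
  | nil => simpa using h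
  | cons l cs ih =>
    obtain ⟨rfl, hcs⟩ := List.forall_mem_cons.1 hcs
    have hrun := hasCircuit_run (ih hcs) c W l cfg (hS.trans Set.subset_union_left)
    have hread := hrun.insert_formula
      ((hf.comp fun x => l.foldl c.step (cfg x)).subset Set.subset_union_right)
    refine (hread.mono ?_).subset ?_
    · rw [List.length_cons]
      exact (by ring : _ = _).le
    · simp only [List.map_cons, List.mem_cons]
      rintro g (hg | rfl | hg)
      · exact .inr (.inl (.inl hg))
      · exact .inl rfl
      · exact .inr (.inl (.inr hg))

/-- A bound for the size of a circuit for the majority vote of `R` runs of `c` of length `T`, if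
`a` gates compute the vote of a run from the features of radius `W` of its last configuration. -/
def voteSize (c : PTM) (T W R a : ℕ) : ℕ :=
  (c.features (W + T)).length + R * (T * c.stepSize (W + T) + a) + (R + 1) * ((R + 2) * 5)

theorem card_filter_run_eq_countP (c : PTM) {T R : ℕ} (inp : List (Option Bool))
    (f : Cfg → Bool) (cs : Fin R → Fin T → Bool) :
    (Finset.univ.filter fun i => f (c.run inp (cs i))).card =
      (List.ofFn fun i => List.ofFn (cs i)).countP fun l => f (l.foldl c.step (init inp)) := by
  rw [List.ofFn_eq_map, List.countP_map, Finset.card_def, Finset.filter_val,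
    ← Multiset.countP_eq_card_filter, Fin.univ_def, Multiset.coe_countP]
  refine List.countP_congr fun i _ => ?_
  simp only [run, Function.comp_apply]
  exact decide_eq_true_iff

theorem hasCircuit_majority {n a T W R : ℕ} (c : PTM) {f : Cfg → Bool}
    (hf : Formula {g | g ∈ c.features W} a f) {inp : (Fin n → Bool) → List (Option Bool)}
    (hinp : ∀ j : ℕ, (∃ o, ∀ x, (inp x)[j]? = o) ∨ ∃ i, ∀ x, (inp x)[j]? = some (some (x i)))
    (cs : Fin R → Fin T → Bool) :
    HasCircuit n (c.voteSize T W R a)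
      {fun x => decide (R < 2 * (Finset.univ.filter fun i => f (c.run (inp x) (cs i))).card)} := by
  have hinit := (HasCircuit.range_apply n).union_formulas
    ((c.features (W + T)).map (· ∘ fun x => init (inp x))) (k := 1) (by
      simp only [List.mem_map, forall_exists_index, and_imp, forall_apply_eq_imp_iff₂]
      refine fun g hg => formula_init (fun j => (hinp j).imp_right ?_) hg
      rintro ⟨i, hi⟩
      exact ⟨fun x => x i, ⟨i, rfl⟩, hi⟩)
  have hruns := hasCircuit_runs (cfg := fun x => init (inp x)) hinit
    (by rintro _ ⟨g, hg, rfl⟩; exact .inr (List.mem_map.2 ⟨g, hg, rfl⟩)) hf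
    (List.ofFn fun i => List.ofFn (cs i)) (by simp [List.mem_ofFn])
  have hvote := hruns.threshold (R / 2 + 1) (bs := (List.ofFn fun i => List.ofFn (cs i)).map
    fun (l : List Bool) x => f (l.foldl c.step (init (inp x)))) fun b hb => .inr hb
  refine (hvote.mono ?_).subset (Set.singleton_subset_iff.2 (.inr ⟨R / 2 + 1, le_rfl, ?_⟩))
  · simp only [voteSize, List.length_map, List.length_ofFn, zero_add, mul_one]
    exact Nat.add_le_add_left (Nat.mul_le_mul_left _ (Nat.mul_le_mul_right _ (by omega))) _
  · funext x
    rw [List.countP_map, decide_eq_decide, c.card_filter_run_eq_countP]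
    simp only [Function.comp_def]
    omega

theorem two_mul_two_pow_lt_of_prob {c : PTM} {inp : List (Option Bool)} {t : ℕ} {E : Cfg → Prop}
    [DecidablePred E] (h : 2 / 3 < c.prob inp t E) :
    2 * 2 ^ t < 3 * (Finset.univ.filter fun coins : Fin t → Bool => E (c.run inp coins)).card := by
  rw [prob, Nat.card_eq_fintype_card, Fintype.card_subtype, lt_div_iff₀ (by positivity)] at h
  have hreal : (2 : ℝ) * 2 ^ t <
      3 * (Finset.univ.filter fun coins : Fin t → Bool => E (c.run inp coins)).card := by
    linarith
  exact_mod_cast hreal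

theorem prob_mono {c : PTM} {inp : List (Option Bool)} {t : ℕ} {E E' : Cfg → Prop}
    (h : ∀ coins : Fin t → Bool, E (c.run inp coins) → E' (c.run inp coins)) :
    c.prob inp t E ≤ c.prob inp t E' := by
  unfold prob
  gcongr
  exact Nat.card_mono (Set.toFinite {coins : Fin t → Bool | E' (c.run inp coins)}) h

end PTM

namespace PolyBounded

variable {c : ℕ → PTM} {W : ℕ → ℕ}

theorem length_features (hc : PolyBounded fun n => (c n).rules.length) (hW : PolyBounded W) :
    PolyBounded fun n => ((c n).features (W n)).length := by
  simp only [PTM.length_features]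
  exact hc.add ((((const 2).mul hW).add (const 1)).mul (hc.add (const 4)))

theorem stepSize (hc : PolyBounded fun n => (c n).rules.length) (hW : PolyBounded W) :
    PolyBounded fun n => (c n).stepSize (W n) :=
  (hc.length_features hW).mul ((hc.mul (const 13)).add (const 1))

theorem voteSize {T R a : ℕ → ℕ} (hc : PolyBounded fun n => (c n).rules.length)
    (hT : PolyBounded T) (hW : PolyBounded W) (hR : PolyBounded R) (ha : PolyBounded a) :
    PolyBounded fun n => (c n).voteSize (T n) (W n) (R n) (a n) :=
  ((hc.length_features (hW.add hT)).add
    (hR.mul ((hT.mul (hc.stepSize (hW.add hT))).add ha))).add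
    ((hR.add (const 1)).mul ((hR.add (const 2)).mul (const 5)))

end PolyBounded

-- Adleman's argument, with the machine itself as part of the advice.
theorem mem_PPoly_of_probabilistic {L : Language Bool} {c : ℕ → PTM} {T W a : ℕ → ℕ}
    {inp : ∀ n, (Fin n → Bool) → List (Option Bool)} {accept : ℕ → PTM.Cfg → Bool}
    (hc : PolyBounded fun n => (c n).rules.length) (hT : PolyBounded T) (hW : PolyBounded W)
    (ha : PolyBounded a)
    (hinp : ∀ (n j : ℕ), (∃ o, ∀ x, (inp n x)[j]? = o) ∨
      ∃ i, ∀ x, (inp n x)[j]? = some (some (x i)))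
    (haccept : ∀ n, Formula {g | g ∈ (c n).features (W n)} (a n) (accept n))
    (hprob : ∀ n x, 2 / 3 < (c n).prob (inp n x) (T n) fun s => accept n s ↔ List.ofFn x ∈ L) :
    L ∈ PPoly := by
  classical
  have hcoins : ∀ n, ∃ cs : Fin (13 * (n + 1)) → Fin (T n) → Bool, ∀ x : Fin n → Bool,
      13 * (n + 1) < 2 * (Finset.univ.filter fun i =>
        accept n ((c n).run (inp n x) (cs i)) ↔ List.ofFn x ∈ L).card := fun n =>
    exists_forall_majority
      (fun x coins => accept n ((c n).run (inp n x) coins) ↔ List.ofFn x ∈ L)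
      (fun x => by simpa using PTM.two_mul_two_pow_lt_of_prob (hprob n x))
      (by simpa using two_pow_mul_seventeen_pow_lt n)
  choose cs hcs using hcoins
  refine mem_PPoly_of_hasCircuit
    (hc.voteSize hT hW ((PolyBounded.const 13).mul (.add .id (.const 1))) ha) fun n => ?_
  refine ((c n).hasCircuit_majority (haccept n) (hinp n) (cs n)).subset ?_
  rw [Set.singleton_subset_singleton]
  funext x
  rw [decide_eq_decide]
  have hmaj := hcs n x
  by_cases hx : List.ofFn x ∈ L
  · simpa only [hx, iff_true, true_iff] using hmaj
  · have hcard := Finset.card_filter_add_card_filter_not (s := Finset.univ) fun i =>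
      accept n ((c n).run (inp n x) (cs n i)) = true
    rw [Finset.card_univ, Fintype.card_fin] at hcard
    simp only [hx, iff_false, false_iff] at hmaj ⊢
    omega

/-! ### From approximate local probabilities to circuits -/

/-- The query of a machine `q n` about the instance `x`: the string `u`, followed by `x` with every
bit preceded by `0`, and by a final `1`. Thus the end of `x` is recognized without lookahead. -/
def query (u x : List Bool) : List Bool := u ++ (x.flatMap (fun b => [false, b]) ++ [true])

theorem length_query (u x : List Bool) : (query u x).length = u.length + 2 * x.length + 1 := by
  simp only [query, List.length_append, List.length_flatMap, List.length_cons, List.length_nil,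
    List.map_const', List.sum_replicate, smul_eq_mul]
  ring

theorem getElem?_query {n : ℕ} (u : List Bool) (l : List (Fin n)) (j : ℕ) :
    (∃ o, ∀ x : Fin n → Bool, ((query u (l.map x)).map some ++ [some false])[j]? = o) ∨
      ∃ i, ∀ x : Fin n → Bool,
        ((query u (l.map x)).map some ++ [some false])[j]? = some (some (x i)) := by
  induction u generalizing j with
  | cons b u ih =>
    cases j with
    | zero => exact .inl ⟨some (some b), fun x => rfl⟩
    | succ j => simpa [query] using ih j
  | nil =>
    induction l generalizing j with
    | nil => exact .inl ⟨[some true, some false][j]?, fun x => rfl⟩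
    | cons k l ih =>
      match j with
      | 0 => exact .inl ⟨some (some false), fun x => rfl⟩
      | 1 => exact .inr ⟨k, fun x => rfl⟩
      | j + 2 => simpa [query] using ih j

section ApproxWithin

variable {lam P : ℝ} {r : ℚ} {j : ℕ}

theorem ApproxWithin.one_le_mul_two_pow (h : ApproxWithin lam r 1) (hlam : 0 < lam)
    (hj : lam ≤ 2 ^ j) : 1 ≤ r * 2 ^ j := by
  have hr : (0 : ℝ) ≤ r := (pos_of_mul_pos_right (one_pos.trans_le h.2) hlam.le).le
  have hreal : (1 : ℝ) ≤ r * 2 ^ j :=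
    calc (1 : ℝ) ≤ lam * r := h.2
      _ ≤ 2 ^ j * r := by gcongr
      _ = r * 2 ^ j := mul_comm _ _
  exact_mod_cast hreal

theorem ApproxWithin.mul_two_pow_le_one (h : ApproxWithin lam r P) (hlam : 0 < lam)
    (hj : lam ≤ 2 ^ j) (hP₀ : 0 ≤ P) (hP : P * 2 ^ (2 * j + 1) ≤ 1) : r * 2 ^ (j + 1) ≤ 1 := by
  have hreal : (r : ℝ) * 2 ^ (j + 1) ≤ 1 :=
    calc (r : ℝ) * 2 ^ (j + 1) ≤ P * lam * 2 ^ (j + 1) := by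
          gcongr
          exact (div_le_iff₀ hlam).1 h.1
      _ ≤ P * 2 ^ j * 2 ^ (j + 1) := by gcongr
      _ = P * 2 ^ (2 * j + 1) := by ring
      _ ≤ 1 := hP
  exact_mod_cast hreal

theorem PTM.largeOutput_iff_not {c : PTM} {inp : List (Option Bool)} {t W : ℕ}
    {coins : Fin t → Bool} (h : c.Outputs (c.run inp coins) r) (hr : ApproxWithin lam r P)
    (hW : inp.length + t + 1 ≤ W) (hlam : 0 < lam) (hj : lam ≤ 2 ^ j) (hP₀ : 0 ≤ P) {a : Prop}
    (hP : a → P * 2 ^ (2 * j + 1) ≤ 1) (hP₁ : ¬ a → P = 1) :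
    largeOutput W j (c.run inp coins) ↔ ¬ a := by
  obtain ⟨-, out, hrep, hright⟩ := h
  have hlen : out.length ≤ W := by
    refine (length_output_le hright).trans ?_
    rwa [List.length_ofFn]
  constructor
  · exact fun hlarge ha => (one_lt_of_largeOutput hright hrep hlen hlarge).not_ge
      (hr.mul_two_pow_le_one hlam hj hP₀ (hP ha))
  · intro ha
    rw [hP₁ ha] at hr
    exact largeOutput_of_one_le hright hrep hlen (hr.one_le_mul_two_pow hlam hj)

end ApproxWithin

theorem PTM.length_rules_le (c : PTM) : c.rules.length ≤ c.encode.length := by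
  rw [encode, List.length_flatMap]
  simpa using List.card_nsmul_le_sum (c.rules.map fun r => (encodeRule r).length) 1 (by
    simp [Nat.succ_le_iff, List.length_pos_iff, encodeRule_ne_nil])

theorem PolyBounded.length_rules {M : TM2ComputableAux Bool Bool} {θ : ℕ → List Bool}
    {q : ℕ → PTM} {build : Polynomial ℕ} (hθ : PolyBounded fun n => (θ n).length)
    (hq : ∀ n, Computes M (θ n) (q n).encode (build.eval n)) :
    PolyBounded fun n => (q n).rules.length := by
  obtain ⟨C, hC⟩ := exists_length_output_le M
  exact (hθ.add ((const C).mul (eval build))).mono fun n =>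
    (q n).length_rules_le.trans (hC _ _ _ (hq n))

theorem mem_PPoly_of_approximatelyLocallyNormalizes {L : Language Bool} {lam : ℝ} {j : ℕ}
    {p : WeightedLanguage} {M : TM2ComputableAux Bool Bool} {θ : ℕ → List Bool}
    (h : ApproximatelyLocallyNormalizes lam p M θ) (hlam : 0 < lam) (hj : lam ≤ 2 ^ j)
    {u : ℕ → List Bool} (hu : PolyBounded fun n => (u n).length)
    (hpos : ∀ x, 0 < localProb p (query (u x.length) x) (some false))
    (hin : ∀ x ∈ L, localProb p (query (u x.length) x) (some false) * 2 ^ (2 * j + 1) ≤ 1)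
    (hout : ∀ x ∉ L, localProb p (query (u x.length) x) (some false) = 1) :
    L ∈ PPoly := by
  obtain ⟨q, size, build, time, hsize, hbuild, -, hprob⟩ := h
  obtain ⟨N, hN⟩ := (hu.add ((PolyBounded.const 2).mul .id)).add (.const 1)
  have hT : PolyBounded fun n => time.eval (N.eval n) := (PolyBounded.eval time).comp N
  have hW : PolyBounded fun n => N.eval n + 1 + time.eval (N.eval n) + 1 :=
    (((PolyBounded.eval N).add (.const 1)).add hT).add (.const 1)
  have hlen {n : ℕ} (x : Fin n → Bool) : (query (u n) (List.ofFn x)).length ≤ N.eval n := by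
    simpa [length_query] using hN n
  refine mem_PPoly_of_probabilistic (c := fun n => q (N.eval n))
    (inp := fun n x => (query (u n) (List.ofFn x)).map some ++ [some false])
    ((PolyBounded.length_rules ⟨size, hsize⟩ hbuild).comp N) hT hW
    ((hW.mul ((hW.mul (((PolyBounded.const 9).mul hW).add (.const 12))).add (.const 4))).add
      (.const 2))
    (fun n i => by simpa only [List.ofFn_eq_map] using getElem?_query (u n) (List.finRange n) i)
    (fun n => (PTM.formula_largeOutput _ _ j).not) fun n x => ?_
  refine (hprob (N.eval n) _ (some false) (hlen x) ?_).trans_le (PTM.prob_mono ?_)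
  · simpa using hpos (List.ofFn x)
  rintro coins ⟨r, hr, happrox⟩
  have hlarge := PTM.largeOutput_iff_not (W := N.eval n + 1 + time.eval (N.eval n) + 1) hr happrox
    (by simpa using hlen x) hlam hj NNReal.zero_le_coe (a := List.ofFn x ∈ L)
    (fun hx => by exact_mod_cast by simpa using hin _ hx)
    (fun hx => by exact_mod_cast by simpa using hout _ hx)
  rw [Bool.not_eq_true', ← Bool.not_eq_true, hlarge, not_not]

/-! ### A weighted language that encodes a verifier -/

/-- The phases of reading a string of the form `1ᵏ 0 1ᵐ 0 0x₁ ⋯ 0xₙ 1` followed by `0` (the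
fallback) or by `1 w₁ ⋯ wₘ` (a witness). In phase `sep` a pair `0xᵢ` or the final `1` is expected,
and `dead` is the phase of all strings without an extension of this form. -/
inductive Phase
  | pad | len | sep | bit | flag | witness | fallback | dead
  deriving DecidableEq

instance : Fintype Phase :=
  ⟨{.pad, .len, .sep, .bit, .flag, .witness, .fallback, .dead}, fun k => by cases k <;> simp⟩

/-- The next phase, given a symbol, where the last argument says whether more witness symbols are
expected. -/
def Phase.next : Phase → Bool → Bool → Phase
  | .pad, true, _ => .pad
  | .pad, false, _ => .len
  | .len, true, _ => .len
  | .len, false, _ => .sep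
  | .sep, false, _ => .bit
  | .sep, true, _ => .flag
  | .bit, _, _ => .sep
  | .flag, false, _ => .fallback
  | .flag, true, _ => .witness
  | .witness, _, true => .witness
  | .witness, _, false => .dead
  | .fallback, _, _ => .dead
  | .dead, _, _ => .dead

/-- What has been read so far: the phase, the number of witness symbols that are still expected (in
unary), and the bits of the instance and of the witness, in reverse (as on the stacks of the machine
below). -/
structure Parse where
  phase : Phase
  len : List Bool
  inst : List Bool
  wit : List Bool

namespace Parse

/-- The state of the parser before the first symbol. -/
def start : Parse := ⟨.pad, [], [], []⟩

/-- The transition function of the parser. -/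
def step (s : Parse) (b : Bool) : Parse where
  phase := s.phase.next b (!s.len.isEmpty)
  len := if s.phase = .len ∧ b = true then true :: s.len else
    if s.phase = .witness then s.len.tail else s.len
  inst := if s.phase = .bit then b :: s.inst else s.inst
  wit := if s.phase = .witness then b :: s.wit else s.wit

/-- The kind of a string: `some true` for a fallback string, `some false` for a string with an
accepted witness, and `none` for all others. -/
def verdict (v : List Bool → List Bool → Bool) (s : Parse) : Option Bool :=
  if s.phase = .fallback then some true
  else if s.phase = .witness ∧ s.len = [] ∧ v s.inst.reverse s.wit.reverse = true then some false
  else none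

theorem phase_foldl_step_dead {s : Parse} (h : s.phase = .dead) (y : List Bool) :
    (y.foldl step s).phase = .dead := by
  induction y generalizing s with
  | nil => exact h
  | cons b _ ih => exact ih (by simp [step, h, Phase.next])

theorem verdict_of_dead (v : List Bool → List Bool → Bool) {s : Parse} (h : s.phase = .dead) :
    s.verdict v = none := by
  simp [verdict, h]

theorem foldl_step_pad (k : ℕ) : (List.replicate k true).foldl step start = start := by
  induction k with
  | zero => rfl
  | succ _ ih => exact ih

theorem foldl_step_len (m : ℕ) (l : List Bool) :
    (List.replicate m true).foldl step ⟨.len, l, [], []⟩ =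
      ⟨.len, List.replicate m true ++ l, [], []⟩ := by
  induction m generalizing l with
  | zero => rfl
  | succ m ih =>
    have hstep : step ⟨.len, l, [], []⟩ true = ⟨.len, true :: l, [], []⟩ := by
      simp [step, Phase.next]
    rw [List.replicate_succ, List.foldl_cons, hstep, ih, ← List.replicate_succ,
      List.replicate_succ', List.append_assoc, List.singleton_append]

theorem foldl_step_inst (x l i : List Bool) :
    (x.flatMap fun b => [false, b]).foldl step ⟨.sep, l, i, []⟩ =
      ⟨.sep, l, x.reverse ++ i, []⟩ := by
  induction x generalizing i with
  | nil => rfl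
  | cons b x ih =>
    have hstep : [false, b].foldl step ⟨.sep, l, i, []⟩ = ⟨.sep, l, b :: i, []⟩ := by
      simp [step, Phase.next]
    rw [List.flatMap_cons, List.foldl_append, hstep, ih, List.reverse_cons, List.append_assoc,
      List.singleton_append]

section Witness

variable {w l : List Bool} (i z : List Bool)

theorem foldl_step_witness (h : w.length ≤ l.length) :
    w.foldl step ⟨.witness, l, i, z⟩ = ⟨.witness, l.drop w.length, i, w.reverse ++ z⟩ := by
  induction w generalizing l z with
  | nil => rfl
  | cons b w ih =>
    obtain ⟨a, l, rfl⟩ := List.exists_cons_of_length_pos ((Nat.succ_pos _).trans_le h)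
    have hstep : step ⟨.witness, a :: l, i, z⟩ b = ⟨.witness, l, i, b :: z⟩ := by
      simp [step, Phase.next]
    rw [List.foldl_cons, hstep, ih (b :: z) (Nat.le_of_succ_le_succ h)]
    simp

theorem phase_foldl_step_witness (h : l.length < w.length) :
    (w.foldl step ⟨.witness, l, i, z⟩).phase = .dead := by
  induction w generalizing l z with
  | nil => exact absurd h (Nat.not_lt_zero _)
  | cons b w ih =>
    cases l with
    | nil => exact phase_foldl_step_dead (by simp [step, Phase.next]) w
    | cons a l =>
      have hstep : step ⟨.witness, a :: l, i, z⟩ b = ⟨.witness, l, i, b :: z⟩ := by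
        simp [step, Phase.next]
      rw [List.foldl_cons, hstep]
      exact ih (b :: z) (Nat.lt_of_succ_lt_succ h)

end Witness

end Parse

/-- The beginning `1ᵏ 0 1ᵐ 0` of a string, where `k` only serves as padding and `m` announces the
length of a witness. -/
def header (k m : ℕ) : List Bool :=
  List.replicate k true ++ false :: (List.replicate m true ++ [false])

theorem length_header (k m : ℕ) : (header k m).length = k + m + 2 := by
  simp only [header, List.length_append, List.length_replicate, List.length_cons, List.length_nil]
  ring

theorem foldl_step_query (k m : ℕ) (x : List Bool) :
    (query (header k m) x).foldl Parse.step .start =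
      ⟨.flag, List.replicate m true, x.reverse, []⟩ := by
  have hlen : Parse.step .start false = ⟨.len, [], [], []⟩ := by
    simp [Parse.step, Parse.start, Phase.next]
  have hsep : Parse.step ⟨.len, List.replicate m true ++ [], [], []⟩ false =
      ⟨.sep, List.replicate m true, [], []⟩ := by
    simp [Parse.step, Phase.next]
  have hflag : Parse.step ⟨.sep, List.replicate m true, x.reverse ++ [], []⟩ true =
      ⟨.flag, List.replicate m true, x.reverse, []⟩ := by
    simp [Parse.step, Phase.next]
  simp only [query, header, List.foldl_append, List.foldl_cons, List.foldl_nil,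
    Parse.foldl_step_pad, hlen, Parse.foldl_step_len, hsep, Parse.foldl_step_inst, hflag]

/-- The weight of a string of length `l`, by kind. -/
noncomputable def kindWeight (l : ℕ) : Option Bool → ℝ≥0
  | none => 0
  | some false => (1 / 4) ^ l
  | some true => (1 / 16) ^ l

/-- The weighted language for a verifier `v`. After the prefix `1ᵏ 0 1ᵐ 0 0x₁ ⋯ 0xₙ 1`, the only
alternatives are the fallback `0` and `1 w₁ ⋯ wₘ` for the witnesses `w` accepted with `x`; even a
single witness makes the conditional probability of `0` smaller than `2⁻ᵏ`. -/
noncomputable def verifierWeight (v : List Bool → List Bool → Bool) : WeightedLanguage := fun y =>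
  kindWeight y.length ((y.foldl Parse.step .start).verdict v)

theorem kindWeight_le (l : ℕ) (o : Option Bool) : kindWeight l o ≤ (1 / 4) ^ l := by
  rcases o with _ | _ | _
  · exact zero_le
  · exact le_rfl
  · have hle : (1 / 16 : ℝ≥0) ≤ 1 / 4 := by
      rw [← NNReal.coe_le_coe]
      norm_num
    exact pow_le_pow_left₀ zero_le hle l

theorem summable_pow_length {α : Type*} [Fintype α] {r : ℝ≥0} (hr : Fintype.card α * r < 1) :
    Summable fun y : List α => r ^ y.length := by
  rw [← (Equiv.sigmaFiberEquiv (List.length (α := α))).summable_iff, NNReal.summable_sigma]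
  have hfin (n : ℕ) : Fintype {l : List α // l.length = n} :=
    inferInstanceAs (Fintype (List.Vector α n))
  refine ⟨fun n => (hasSum_fintype _).summable, (NNReal.summable_geometric hr).congr fun n => ?_⟩
  have hcard : Fintype.card {l : List α // l.length = n} = Fintype.card α ^ n := by
    rw [← card_vector (α := α) n]
    exact Fintype.card_congr (Equiv.refl _)
  have hterm (y : {l : List α // l.length = n}) :
      ((fun y : List α => r ^ y.length) ∘ Equiv.sigmaFiberEquiv List.length) ⟨n, y⟩ = r ^ n :=
    congrArg (r ^ ·) y.2
  rw [tsum_fintype, Finset.sum_congr rfl fun y _ => hterm y, Finset.sum_const, Finset.card_univ,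
    hcard, nsmul_eq_mul, Nat.cast_pow, mul_pow]

theorem summable_verifierWeight (v : List Bool → List Bool → Bool) :
    Summable (verifierWeight v) :=
  NNReal.summable_of_le (fun _ => kindWeight_le _ _) <| summable_pow_length <| by
    rw [← NNReal.coe_lt_coe]
    norm_num

section PrefixWeight

variable {p : WeightedLanguage} {y z : List Bool}

theorem prefixWeight_eq_single (hz : y <+: z) (h : ∀ z', y <+: z' → z' ≠ z → p z' = 0) :
    prefixWeight p y = p z := by
  rw [prefixWeight, tsum_eq_single ⟨z, hz⟩]
  rintro ⟨z', hz'⟩ hne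
  exact h z' hz' fun he => hne (Subtype.ext he)

theorem le_prefixWeight (hp : Summable p) (hz : y <+: z) : p z ≤ prefixWeight p y :=
  (NNReal.summable_comp_injective hp
    (Subtype.val_injective (p := (y <+: ·)))).le_tsum ⟨z, hz⟩ fun _ _ => zero_le

end PrefixWeight

section VerifierWeight

variable (v : List Bool → List Bool → Bool) (k m : ℕ) (x : List Bool)

theorem verifierWeight_query_append (z : List Bool) :
    verifierWeight v (query (header k m) x ++ z) =
      kindWeight ((query (header k m) x).length + z.length)
        ((z.foldl Parse.step ⟨.flag, List.replicate m true, x.reverse, []⟩).verdict v) := by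
  rw [verifierWeight, List.foldl_append, foldl_step_query, List.length_append]

theorem verifierWeight_query : verifierWeight v (query (header k m) x) = 0 := by
  simpa [Parse.verdict, kindWeight] using verifierWeight_query_append v k m x []

theorem verifierWeight_fallback :
    verifierWeight v (query (header k m) x ++ [false]) =
      (1 / 16) ^ ((query (header k m) x).length + 1) := by
  rw [verifierWeight_query_append]
  simp [Parse.step, Phase.next, Parse.verdict, kindWeight]

theorem verifierWeight_fallback_append {z : List Bool} (hz : z ≠ []) :
    verifierWeight v (query (header k m) x ++ false :: z) = 0 := by
  obtain ⟨b, z, rfl⟩ := List.exists_cons_of_ne_nil hz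
  rw [verifierWeight_query_append, List.foldl_cons, List.foldl_cons, Parse.verdict_of_dead]
  · rfl
  · exact Parse.phase_foldl_step_dead (by simp [Parse.step, Phase.next]) z

theorem verifierWeight_true_append (z : List Bool) :
    verifierWeight v (query (header k m) x ++ true :: z) =
      if z.length = m ∧ v x z then (1 / 4) ^ ((query (header k m) x).length + 1 + m) else 0 := by
  have hstep : Parse.step ⟨.flag, List.replicate m true, x.reverse, []⟩ true =
      ⟨.witness, List.replicate m true, x.reverse, []⟩ := by
    simp [Parse.step, Phase.next]
  rw [verifierWeight_query_append, List.foldl_cons, hstep]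
  rcases le_or_gt z.length m with hz | hz
  · rw [Parse.foldl_step_witness _ _ (by simpa using hz)]
    have hdrop : (List.replicate m true).drop z.length = [] ↔ z.length = m := by
      rw [List.drop_eq_nil_iff, List.length_replicate]
      exact ⟨hz.antisymm, Eq.ge⟩
    have hverdict : Parse.verdict v ⟨.witness, (List.replicate m true).drop z.length,
        x.reverse, z.reverse ++ []⟩ = if z.length = m ∧ v x z then some false else none := by
      simp only [Parse.verdict, reduceCtorEq, if_false, true_and, hdrop, List.append_nil,
        List.reverse_reverse]
    rw [hverdict, List.length_cons]
    split_ifs with hv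
    · rw [kindWeight, hv.1, add_assoc, add_comm 1 m]
    · rfl
  · rw [Parse.verdict_of_dead _ (Parse.phase_foldl_step_witness _ _ (by simpa using hz)),
      if_neg fun h => hz.ne' h.1]
    rfl

theorem normalizable_verifierWeight : Normalizable (verifierWeight v) := by
  refine ⟨summable_verifierWeight v,
    NNReal.tsum_pos (summable_verifierWeight v) (query (header 0 0) [] ++ [false]) ?_⟩
  rw [verifierWeight_fallback]
  positivity

theorem prefixWeight_fallback :
    prefixWeight (verifierWeight v) (query (header k m) x ++ [false]) =
      (1 / 16) ^ ((query (header k m) x).length + 1) := by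
  rw [← verifierWeight_fallback v]
  refine prefixWeight_eq_single (List.prefix_refl _) ?_
  rintro _ ⟨z, rfl⟩ hne
  rw [List.append_assoc]
  exact verifierWeight_fallback_append v k m x fun hz => hne <| by
    rw [show z = [] from hz, List.append_nil]

theorem prefixWeight_query_pos :
    0 < prefixWeight (verifierWeight v) (query (header k m) x) := by
  refine lt_of_lt_of_le ?_
    (le_prefixWeight (summable_verifierWeight v) (List.prefix_append _ [false]))
  rw [verifierWeight_fallback]
  positivity

theorem localProb_query_pos :
    0 < localProb (verifierWeight v) (query (header k m) x) (some false) := by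
  rw [localProb, prefixWeight_fallback]
  exact div_pos (by positivity) (prefixWeight_query_pos v k m x)

variable {v m x}

theorem localProb_query_eq_one (hv : ∀ w, w.length = m → v x w = false) :
    localProb (verifierWeight v) (query (header k m) x) (some false) = 1 := by
  have hprefix : prefixWeight (verifierWeight v) (query (header k m) x) =
      verifierWeight v (query (header k m) x ++ [false]) := by
    refine prefixWeight_eq_single (List.prefix_append _ _) ?_
    rintro _ ⟨_ | ⟨_ | _, z⟩, rfl⟩ hne
    · rw [List.append_nil, verifierWeight_query]
    · exact verifierWeight_fallback_append v k m x fun hz => hne (by rw [hz])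
    · rw [verifierWeight_true_append, if_neg]
      rintro ⟨hz, hvz⟩
      simp [hv z hz] at hvz
  rw [localProb, prefixWeight_fallback, hprefix, verifierWeight_fallback]
  exact div_self (by positivity)

theorem sixteenth_pow_mul_two_pow_le {n : ℕ} (h : k + 2 * m ≤ 2 * n) :
    (1 / 16 : ℝ≥0) ^ n * 2 ^ k ≤ (1 / 4) ^ (n + m) := by
  have hfour : (1 / 4 : ℝ≥0) = (1 / 2) ^ 2 := by norm_num
  have hhalf : (1 / 4 : ℝ≥0) ^ n ≤ (1 / 2) ^ k * (1 / 4) ^ m := by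
    rw [hfour, ← pow_mul, ← pow_mul, ← pow_add]
    exact pow_le_pow_of_le_one zero_le (by rw [← NNReal.coe_le_coe]; norm_num) h
  calc (1 / 16 : ℝ≥0) ^ n * 2 ^ k = (1 / 4) ^ n * (1 / 4) ^ n * 2 ^ k := by
        rw [← mul_pow]
        norm_num
    _ ≤ (1 / 4) ^ n * ((1 / 2) ^ k * (1 / 4) ^ m) * 2 ^ k := by gcongr
    _ = (1 / 4) ^ n * (1 / 4) ^ m * ((1 / 2) ^ k * 2 ^ k) := by ring
    _ = (1 / 4) ^ (n + m) := by
        rw [← mul_pow, one_div_mul_cancel two_ne_zero, one_pow, mul_one, pow_add]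

theorem localProb_query_mul_le_one {w : List Bool} (hw : w.length = m) (hv : v x w = true) :
    localProb (verifierWeight v) (query (header k m) x) (some false) * 2 ^ k ≤ 1 := by
  have hwit := le_prefixWeight (summable_verifierWeight v)
    (List.prefix_append (query (header k m) x) (true :: w))
  rw [verifierWeight_true_append, if_pos ⟨hw, hv⟩] at hwit
  rw [localProb, prefixWeight_fallback, div_mul_eq_mul_div,
    div_le_one (prefixWeight_query_pos v k m x)]
  refine (sixteenth_pow_mul_two_pow_le k ?_).trans hwit
  rw [length_query, length_header]
  omega

end VerifierWeight

/-! ### A machine that computes the weights -/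

namespace Parse

theorem length_foldl_step_le (y : List Bool) (s : Parse) :
    (y.foldl step s).len.length + (y.foldl step s).inst.length + (y.foldl step s).wit.length ≤
      s.len.length + s.inst.length + s.wit.length + y.length := by
  induction y generalizing s with
  | nil => exact le_rfl
  | cons b y ih =>
    have hstep : (s.step b).len.length + (s.step b).inst.length + (s.step b).wit.length ≤
        s.len.length + s.inst.length + s.wit.length + 1 := by
      obtain ⟨ph, l, i, w⟩ := s
      cases ph <;> cases b <;> simp [step] <;> omega
    rw [List.foldl_cons, List.length_cons]
    have hrest := ih (s.step b)
    omega

end Parse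

namespace WeightMachine

/-- The stacks in addition to those of the verifier: the input, a counter for its length, the three
components of a `Parse`, and the output. -/
inductive Aux
  | inp | cnt | len | inst | wit | out
  deriving DecidableEq

instance : Fintype Aux :=
  ⟨{.inp, .cnt, .len, .inst, .wit, .out}, fun k => by cases k <;> simp⟩

/-- The alphabets of the additional stacks. -/
@[reducible] def AuxAlphabet : Aux → Type
  | .out => Option Bool
  | _ => Bool

/-- The labels in addition to those of the verifier: parsing the input, passing the witness and the
instance to the verifier, reading its verdict, emptying the stacks, and writing the output. -/
inductive Label
  | read | loadWit | loadInst | verdict | clear | emit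
  deriving DecidableEq

instance : Fintype Label :=
  ⟨{.read, .loadWit, .loadInst, .verdict, .clear, .emit}, fun k => by cases k <;> simp⟩

/-- The registers in addition to the state of the verifier: the phase of the parser, the symbols
popped in the current step, and the kind of the input. -/
structure Reg where
  phase : Phase
  a : Option Bool
  b : Option Bool
  c : Option Bool
  kind : Option Bool
  deriving Fintype

/-- The registers between two steps. -/
def reg (ph : Phase) (kind : Option Bool) : Reg := ⟨ph, none, none, none, kind⟩

section Machine

variable (V : TM2ComputableAux (Option Bool) Bool)

/-- The stack alphabets. -/
@[reducible] def Alphabet : V.tm.K ⊕ Aux → Type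
  | .inl k => V.tm.Γ k
  | .inr k => AuxAlphabet k

/-- The statements of the machine. -/
abbrev Stmt : Type := TM2.Stmt (Alphabet V) (V.tm.Λ ⊕ Label) (V.tm.σ × Reg)

open TM2.Stmt

/-- A statement of the verifier, as a statement of the machine. -/
def lift : TM2.Stmt V.tm.Γ V.tm.Λ V.tm.σ → Stmt V
  | push k f q => push (.inl k) (fun s => f s.1) (lift q)
  | peek k f q => peek (.inl k) (fun s a => (f s.1 a, s.2)) (lift q)
  | pop k f q => pop (.inl k) (fun s a => (f s.1 a, s.2)) (lift q)
  | load f q => load (fun s => (f s.1, s.2)) (lift q)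
  | branch f q₁ q₂ => branch (fun s => f s.1) (lift q₁) (lift q₂)
  | goto f => goto fun s => .inl (f s.1)
  | halt => goto fun _ => .inr .verdict

/-- The end of every step: empty the scratch registers and go to `l`. -/
def jump (l : V.tm.Λ ⊕ Label) : Stmt V :=
  load (fun s => (s.1, reg s.2.phase s.2.kind)) <| goto fun _ => l

/-- The end of a step that determines the kind of the input. -/
def classify (f : Reg → Option Bool) : Stmt V :=
  load (fun s => (s.1, { s.2 with kind := f s.2 })) <| jump V (.inr .clear)

/-- The end of a step that reads the symbol in register `a`. -/
def advance : Stmt V :=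
  load (fun s => (s.1, { s.2 with phase := s.2.phase.next (s.2.a.getD false) s.2.b.isSome })) <|
    jump V (.inr .read)

/-- The program: run the parser on the input, run the verifier if the parser ends in a complete
witness, and write the weight as a fraction whose denominator is a power of two. -/
def program : V.tm.Λ ⊕ Label → Stmt V
  | .inl l => lift V (V.tm.m l)
  | .inr .read =>
    pop (.inr .inp) (fun s a => (s.1, { s.2 with a := a })) <|
    branch (fun s => s.2.a.isSome)
      (push (.inr .cnt) (fun _ => true) <|
       branch (fun s => decide (s.2.phase = .witness))
        (push (.inr .wit) (fun s => s.2.a.getD false) <|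
         pop (.inr .len) (fun s b => (s.1, { s.2 with b := b })) <| advance V) <|
       branch (fun s => decide (s.2.phase = .len) && s.2.a == some true)
        (push (.inr .len) (fun _ => true) <| advance V) <|
       branch (fun s => decide (s.2.phase = .bit))
        (push (.inr .inst) (fun s => s.2.a.getD false) <| advance V) <|
       advance V) <|
    branch (fun s => decide (s.2.phase = .fallback)) (classify V fun _ => some true) <|
    branch (fun s => decide (s.2.phase = .witness))
      (pop (.inr .len) (fun s b => (s.1, { s.2 with b := b })) <|
       branch (fun s => s.2.b.isSome) (classify V fun _ => none) <| jump V (.inr .loadWit)) <|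
    classify V fun _ => none
  | .inr .loadWit =>
    pop (.inr .wit) (fun s a => (s.1, { s.2 with a := a })) <|
    push (.inl V.tm.k₀) (fun s => V.inputAlphabet.symm s.2.a) <|
    branch (fun s => s.2.a.isSome) (jump V (.inr .loadWit)) (jump V (.inr .loadInst))
  | .inr .loadInst =>
    pop (.inr .inst) (fun s a => (s.1, { s.2 with a := a })) <|
    branch (fun s => s.2.a.isSome)
      (push (.inl V.tm.k₀) (fun s => V.inputAlphabet.symm s.2.a) <| jump V (.inr .loadInst))
      (jump V (.inl V.tm.main))
  | .inr .verdict =>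
    pop (.inl V.tm.k₁) (fun s a => (s.1, { s.2 with a := a.map V.outputAlphabet })) <|
    classify V fun r => if r.a = some true then some false else none
  | .inr .clear =>
    pop (.inr .len) (fun s a => (s.1, { s.2 with a := a })) <|
    pop (.inr .inst) (fun s a => (s.1, { s.2 with b := a })) <|
    pop (.inr .wit) (fun s a => (s.1, { s.2 with c := a })) <|
    branch (fun s => s.2.a.isSome || s.2.b.isSome || s.2.c.isSome)
      (jump V (.inr .clear))
      (push (.inr .out) (fun _ => some true) <| jump V (.inr .emit))
  | .inr .emit =>
    pop (.inr .cnt) (fun s a => (s.1, { s.2 with a := a })) <|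
    branch (fun s => s.2.a.isSome)
      (push (.inr .out) (fun _ => some false) <|
       push (.inr .out) (fun _ => some false) <|
       branch (fun s => decide (s.2.kind = some true))
        (push (.inr .out) (fun _ => some false) <|
         push (.inr .out) (fun _ => some false) <| jump V (.inr .emit)) <|
       jump V (.inr .emit)) <|
    push (.inr .out) (fun _ => none) <|
    push (.inr .out) (fun s => some s.2.kind.isSome) <|
    load (fun _ => (V.tm.initialState, reg .pad none)) halt

/-- A machine that computes `verifierWeight v`, if `V` computes `v`. -/
def machine : TM2ComputableAux Bool (Option Bool) where
  tm :=
    { K := V.tm.K ⊕ Aux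
      kFin := @instFintypeSum _ _ V.tm.kFin _
      k₀ := .inr .inp
      k₁ := .inr .out
      Γ := Alphabet V
      Λ := V.tm.Λ ⊕ Label
      ΛFin := @instFintypeSum _ _ V.tm.ΛFin _
      main := .inr .read
      σ := V.tm.σ × Reg
      σFin := @instFintypeProd _ _ V.tm.σFin _
      initialState := (V.tm.initialState, reg .pad none)
      Γk₀Fin := inferInstanceAs (Fintype Bool)
      m := program V }
  inputAlphabet := Equiv.refl _
  outputAlphabet := Equiv.refl _

end Machine

variable {V : TM2ComputableAux (Option Bool) Bool}

/-- The contents of the stacks, in the order of `Aux`, where `S` are the stacks of the verifier. -/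
def store (S : ∀ k, List (V.tm.Γ k)) (i c l x w : List Bool) (o : List (Option Bool)) :
    ∀ k, List (Alphabet V k)
  | .inl k => S k
  | .inr .inp => i
  | .inr .cnt => c
  | .inr .len => l
  | .inr .inst => x
  | .inr .wit => w
  | .inr .out => o

section Store

variable (S : ∀ k, List (V.tm.Γ k)) (i c l x w z : List Bool) (o o' : List (Option Bool))

@[simp] theorem store_inl (k : V.tm.K) : store S i c l x w o (.inl k) = S k := rfl

@[simp] theorem store_inp : store S i c l x w o (.inr .inp) = i := rfl

@[simp] theorem store_cnt : store S i c l x w o (.inr .cnt) = c := rfl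

@[simp] theorem store_len : store S i c l x w o (.inr .len) = l := rfl

@[simp] theorem store_inst : store S i c l x w o (.inr .inst) = x := rfl

@[simp] theorem store_wit : store S i c l x w o (.inr .wit) = w := rfl

@[simp] theorem store_out : store S i c l x w o (.inr .out) = o := rfl

@[simp] theorem update_inl (k : V.tm.K) (s : List (V.tm.Γ k)) :
    Function.update (store S i c l x w o) (.inl k) s =
      store (Function.update S k s) i c l x w o := by
  funext k'
  rcases k' with k' | _ | _ | _ | _ | _ | _
  · rcases eq_or_ne k' k with rfl | h
    · simp only [Function.update_self, store_inl]
    · rw [Function.update_of_ne (by simpa using h), store_inl, store_inl, Function.update_of_ne h]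
  all_goals rfl

@[simp] theorem update_inp :
    Function.update (store S i c l x w o) (.inr .inp) z = store S z c l x w o := by
  funext k
  rcases k with _ | _ | _ | _ | _ | _ | _ <;> rfl

@[simp] theorem update_cnt :
    Function.update (store S i c l x w o) (.inr .cnt) z = store S i z l x w o := by
  funext k
  rcases k with _ | _ | _ | _ | _ | _ | _ <;> rfl

@[simp] theorem update_len :
    Function.update (store S i c l x w o) (.inr .len) z = store S i c z x w o := by
  funext k
  rcases k with _ | _ | _ | _ | _ | _ | _ <;> rfl

@[simp] theorem update_inst :
    Function.update (store S i c l x w o) (.inr .inst) z = store S i c l z w o := by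
  funext k
  rcases k with _ | _ | _ | _ | _ | _ | _ <;> rfl

@[simp] theorem update_wit :
    Function.update (store S i c l x w o) (.inr .wit) z = store S i c l x z o := by
  funext k
  rcases k with _ | _ | _ | _ | _ | _ | _ <;> rfl

@[simp] theorem update_out :
    Function.update (store S i c l x w o) (.inr .out) o' = store S i c l x w o' := by
  funext k
  rcases k with _ | _ | _ | _ | _ | _ | _ <;> rfl

end Store

/-- The stacks of the verifier, all empty but one. -/
def single (k : V.tm.K) (s : List (V.tm.Γ k)) : ∀ k, List (V.tm.Γ k) :=
  Function.update (fun _ => []) k s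

section Single

variable (k : V.tm.K) (s s' : List (V.tm.Γ k))

@[simp] theorem single_self : single k s k = s := Function.update_self ..

theorem single_of_ne {k' : V.tm.K} (h : k' ≠ k) : single k s k' = [] := Function.update_of_ne h ..

@[simp] theorem update_single : Function.update (single k s) k s' = single k s' :=
  Function.update_idem ..

@[simp] theorem single_nil : single k [] = fun _ => ([] : List (V.tm.Γ _)) :=
  Function.update_eq_self ..

end Single

/-- The running configurations between two steps, outside of the verifier. -/
def cfg (lab : Label) (kind : Option Bool) (S : ∀ k, List (V.tm.Γ k)) (i c : List Bool) (s : Parse)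
    (o : List (Option Bool)) : TM2.Cfg (Alphabet V) (V.tm.Λ ⊕ Label) (V.tm.σ × Reg) :=
  ⟨some (.inr lab), (V.tm.initialState, reg s.phase kind), store S i c s.len s.inst s.wit o⟩

/-- A configuration of the verifier, as a configuration of the machine. -/
def liftCfg (r : Reg) (c : List Bool) (a : TM2.Cfg V.tm.Γ V.tm.Λ V.tm.σ) :
    TM2.Cfg (Alphabet V) (V.tm.Λ ⊕ Label) (V.tm.σ × Reg) :=
  ⟨some (a.l.elim (.inr .verdict) .inl), (a.var, r), store a.stk [] c [] [] [] []⟩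

section Runs

variable (S : ∀ k, List (V.tm.Γ k)) (c : List Bool)

theorem reach_read_cons (s : Parse) (b : Bool) (y : List Bool) :
    ReachesWithin (TM2.step (program V)) (cfg .read none S (b :: y) c s []) 1
      (cfg .read none S y (true :: c) (s.step b) []) := by
  obtain ⟨ph, l, x, w⟩ := s
  refine .single ?_
  rcases ph with _ | _ | _ | _ | _ | _ | _ | _ <;> cases b <;> cases l <;>
    simp [cfg, program, reg, advance, jump, Parse.step, Phase.next]

theorem reach_read (s : Parse) (y : List Bool) :
    ReachesWithin (TM2.step (program V)) (cfg .read none S y c s []) y.length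
      (cfg .read none S [] (List.replicate y.length true ++ c) (y.foldl Parse.step s) []) := by
  induction y generalizing c s with
  | nil => exact .refl _
  | cons b y ih =>
    have hrun := (reach_read_cons S c s b y).trans (ih (true :: c) (s.step b))
    rw [List.length_cons, List.replicate_succ', List.append_assoc]
    exact hrun.mono (add_comm _ _).le

theorem reach_loadWit (ph : Phase) (x w : List Bool) (s : List (Option Bool)) :
    ReachesWithin (TM2.step (program V))
      (cfg .loadWit none (single V.tm.k₀ (s.map V.inputAlphabet.symm)) [] c ⟨ph, [], x, w⟩ [])
      (w.length + 1)
      (cfg .loadInst none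
        (single V.tm.k₀ ((none :: (w.reverse.map some ++ s)).map V.inputAlphabet.symm)) [] c
        ⟨ph, [], x, []⟩ []) := by
  induction w generalizing s with
  | nil => exact .single (by simp [cfg, program, reg, jump])
  | cons b w ih =>
    refine .head ?_ (by simpa using ih (some b :: s))
    simp [cfg, program, reg, jump]

theorem reach_loadInst (ph : Phase) (x : List Bool) (s : List (Option Bool)) :
    ReachesWithin (TM2.step (program V))
      (cfg .loadInst none (single V.tm.k₀ (s.map V.inputAlphabet.symm)) [] c ⟨ph, [], x, []⟩ [])
      (x.length + 1)
      (liftCfg (reg ph none) c ⟨some V.tm.main, V.tm.initialState,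
        single V.tm.k₀ ((x.reverse.map some ++ s).map V.inputAlphabet.symm)⟩) := by
  induction x generalizing s with
  | nil => exact .single (by simp [cfg, liftCfg, program, reg, jump])
  | cons b x ih =>
    refine .head ?_ (by simpa using ih (some b :: s))
    simp [cfg, program, reg, jump]

theorem stepAux_lift (r : Reg) (q : TM2.Stmt V.tm.Γ V.tm.Λ V.tm.σ) (s : V.tm.σ) :
    TM2.stepAux (lift V q) (s, r) (store S [] c [] [] [] []) =
      liftCfg r c (TM2.stepAux q s S) := by
  induction q generalizing s S with
  | push k f q ih => simp [lift, ih]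
  | peek k f q ih => simp [lift, ih]
  | pop k f q ih => simp [lift, ih]
  | load f q ih => simp [lift, ih]
  | branch f q₁ q₂ ih₁ ih₂ =>
    simp only [lift, TM2.stepAux]
    cases f s
    · exact ih₂ S s
    · exact ih₁ S s
  | goto f => rfl
  | halt => rfl

theorem reach_lift (r : Reg) {a b : TM2.Cfg V.tm.Γ V.tm.Λ V.tm.σ} {t : ℕ}
    (h : ReachesWithin (TM2.step V.tm.m) a t b) :
    ReachesWithin (TM2.step (program V)) (liftCfg r c a) t (liftCfg r c b) := by
  refine h.map (liftCfg r c) ?_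
  rintro ⟨_ | l, s, S⟩ b hb
  · cases hb
  · obtain rfl : TM2.stepAux (V.tm.m l) s S = b := Option.some.inj hb
    exact congrArg some (stepAux_lift S c r (V.tm.m l) s)

theorem reach_verifier (ph : Phase) {x w : List Bool} {b : Bool} {t : ℕ}
    (h : Computes V (pairEnc x.reverse w.reverse) [b] t) :
    ReachesWithin (TM2.step (program V)) (cfg .loadWit none (fun _ => []) [] c ⟨ph, [], x, w⟩ [])
      (x.length + w.length + t + 3)
      (cfg .clear (if b then some false else none) (fun _ => []) [] c ⟨ph, [], [], []⟩ []) := by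
  rw [computes_iff, initList_eq (single_self V.tm.k₀ _) fun k hk => single_of_ne _ _ hk,
    haltList_eq (single_self V.tm.k₁ _) fun k hk => single_of_ne _ _ hk] at h
  have hwit := reach_loadWit c ph x w (V := V) []
  have hinst := reach_loadInst c ph x (V := V) (none :: (w.reverse.map some ++ []))
  rw [List.map_nil, single_nil, List.append_nil] at hwit
  rw [List.append_nil] at hinst
  have hverdict : ReachesWithin (TM2.step (program V))
      (liftCfg (reg ph none) c ⟨none, V.tm.initialState,
        single V.tm.k₁ ([b].map V.outputAlphabet.symm)⟩) 1
      (cfg .clear (if b then some false else none) (fun _ => []) [] c ⟨ph, [], [], []⟩ []) :=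
    .single (by cases b <;> simp [cfg, liftCfg, program, reg, jump, classify])
  exact (((hwit.trans hinst).trans (reach_lift c _ h)).trans hverdict).mono (by omega)

theorem reach_clear (kind : Option Bool) {s : Parse} {n : ℕ}
    (h : s.len.length + s.inst.length + s.wit.length ≤ n) :
    ReachesWithin (TM2.step (program V)) (cfg .clear kind S [] c s []) (n + 1)
      (cfg .emit kind S [] c ⟨s.phase, [], [], []⟩ [some true]) := by
  obtain ⟨ph, l, x, w⟩ := s
  have hempty : ReachesWithin (TM2.step (program V)) (cfg .clear kind S [] c ⟨ph, [], [], []⟩ []) 1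
      (cfg .emit kind S [] c ⟨ph, [], [], []⟩ [some true]) :=
    .single (by simp [cfg, program, reg, jump])
  induction n generalizing l x w with
  | zero =>
    obtain ⟨⟨rfl, rfl⟩, rfl⟩ : (l = [] ∧ x = []) ∧ w = [] := by simpa using h
    exact hempty
  | succ n ih =>
    by_cases hnil : l = [] ∧ x = [] ∧ w = []
    · obtain ⟨rfl, rfl, rfl⟩ := hnil
      exact hempty.mono (by omega)
    · have htail : l.tail.length + x.tail.length + w.tail.length ≤ n := by
        simp only [← List.length_eq_zero_iff] at hnil
        simp only [List.length_tail] at h ⊢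
        omega
      refine .head ?_ (ih l.tail x.tail w.tail htail)
      rcases l with _ | ⟨a, l⟩ <;> rcases x with _ | ⟨b, x⟩ <;> rcases w with _ | ⟨d, w⟩ <;>
        first | exact absurd ⟨rfl, rfl, rfl⟩ hnil | simp [cfg, program, reg, jump]

theorem reach_kind {v : List Bool → List Bool → Bool} {T : ℕ → ℕ} (hT : Monotone T)
    (hV : ∀ x w, Computes V (pairEnc x w) [v x w] (T (x.length + w.length))) {s : Parse} {n : ℕ}
    (hs : s.len.length + s.inst.length + s.wit.length ≤ n) :
    ReachesWithin (TM2.step (program V)) (cfg .read none (fun _ => []) [] c s [])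
      (T n + 2 * n + 5)
      (cfg .emit (s.verdict v) (fun _ => []) [] c ⟨s.phase, [], [], []⟩ [some true]) := by
  suffices hclear : ∃ s' : Parse, s'.phase = s.phase ∧
      s'.len.length + s'.inst.length + s'.wit.length ≤ n ∧
      ReachesWithin (TM2.step (program V)) (cfg .read none (fun _ => []) [] c s [])
        (T n + n + 4) (cfg .clear (s.verdict v) (fun _ => []) [] c s' []) by
    obtain ⟨s', hphase, hs', hrun⟩ := hclear
    exact hphase ▸ (hrun.trans (reach_clear (fun _ => []) c _ hs')).mono (by omega)
  obtain ⟨ph, l, x, w⟩ := s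
  by_cases hdone : ph = .witness ∧ l = []
  · obtain ⟨rfl, rfl⟩ := hdone
    have hload : ReachesWithin (TM2.step (program V))
        (cfg .read none (fun _ => []) [] c ⟨.witness, [], x, w⟩ []) 1
        (cfg .loadWit none (fun _ => []) [] c ⟨.witness, [], x, w⟩ []) :=
      .single (by simp [cfg, program, reg, jump])
    have hverdict : Parse.verdict v ⟨.witness, [], x, w⟩ =
        if v x.reverse w.reverse = true then some false else none := by
      simp [Parse.verdict]
    have hlen : x.length + w.length ≤ n := by simpa using hs
    have hTn : T (x.reverse.length + w.reverse.length) ≤ T n :=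
      hT (by rwa [List.length_reverse, List.length_reverse])
    exact ⟨⟨.witness, [], [], []⟩, rfl, Nat.zero_le _,
      hverdict ▸ (hload.trans (reach_verifier c _ (hV _ _))).mono (by omega)⟩
  · have hlen : (if ph = .witness then l.tail else l).length + x.length + w.length ≤ n := by
      refine le_trans ?_ hs
      split_ifs <;> simp
    refine ⟨⟨ph, if ph = .witness then l.tail else l, x, w⟩, rfl, hlen,
      (ReachesWithin.single ?_).mono (by omega)⟩
    rcases ph with _ | _ | _ | _ | _ | _ | _ | _ <;> cases l <;>
      first
      | exact absurd ⟨rfl, rfl⟩ hdone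
      | simp [cfg, program, reg, jump, classify, Parse.verdict]

/-- The exponent of two in the denominator of the weight, per symbol of the string. -/
def rate (kind : Option Bool) : ℕ := if kind = some true then 4 else 2

/-- The weight of a string of length `l`, by kind, as a fraction with numerator `0` or `1` and with
a power of two as the denominator. -/
def encodeWeight (l : ℕ) (kind : Option Bool) : List (Option Bool) :=
  pairEnc [kind.isSome] (List.replicate (rate kind * l) false ++ [true])

theorem reach_emit (kind : Option Bool) (ph : Phase) (o : List (Option Bool)) :
    ReachesWithin (TM2.step (program V)) (cfg .emit kind S [] c ⟨ph, [], [], []⟩ o) (c.length + 1)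
      ⟨none, (V.tm.initialState, reg .pad none), store S [] [] [] [] []
        (some kind.isSome :: none ::
          (List.replicate (rate kind * c.length) (some false) ++ o))⟩ := by
  induction c generalizing o with
  | nil => exact .single (by simp [cfg, program, reg, jump])
  | cons a c ih =>
    have hrest := ih (List.replicate (rate kind) (some false) ++ o)
    rw [← List.append_assoc, List.replicate_append_replicate, ← Nat.mul_succ] at hrest
    refine .head ?_ hrest
    by_cases hkind : kind = some true
    · subst hkind
      simp [cfg, program, reg, jump, rate]
    · simp [cfg, program, reg, jump, rate, hkind]

end Runs

theorem computes {v : List Bool → List Bool → Bool} {T : ℕ → ℕ} (hT : Monotone T)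
    (hV : ∀ x w, Computes V (pairEnc x w) [v x w] (T (x.length + w.length))) (y : List Bool) :
    Computes (machine V) y (encodeWeight y.length ((y.foldl Parse.step .start).verdict v))
      (T y.length + 4 * y.length + 6) := by
  set s := y.foldl Parse.step .start
  have hout : encodeWeight y.length (s.verdict v) = some (s.verdict v).isSome :: none ::
      (List.replicate (rate (s.verdict v) * y.length) (some false) ++ [some true]) := by
    simp [encodeWeight, pairEnc]
  have hinit : initList (machine V).tm (y.map (machine V).inputAlphabet.symm) =
      cfg .read none (fun _ => []) y [] .start [] :=
    initList_eq (List.map_id _).symm <| by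
      rintro (_ | _ | _ | _ | _ | _ | _) hk <;> first | rfl | exact (hk rfl).elim
  have hhalt : haltList (machine V).tm ((encodeWeight y.length (s.verdict v)).map
      (machine V).outputAlphabet.symm) = ⟨none, (V.tm.initialState, reg .pad none),
        store (fun _ => []) [] [] [] [] [] (encodeWeight y.length (s.verdict v))⟩ :=
    haltList_eq (List.map_id _).symm <| by
      rintro (_ | _ | _ | _ | _ | _ | _) hk <;> first | rfl | exact (hk rfl).elim
  have hlen : s.len.length + s.inst.length + s.wit.length ≤ y.length :=
    (Parse.length_foldl_step_le y .start).trans_eq (zero_add _)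
  have hread := reach_read (V := V) (fun _ => []) [] .start y
  have hemit := reach_emit (V := V) (fun _ => []) (List.replicate y.length true)
    (s.verdict v) s.phase [some true]
  rw [List.append_nil] at hread
  rw [List.length_replicate] at hemit
  rw [computes_iff, hinit, hhalt, hout]
  exact ((hread.trans (reach_kind _ hT hV hlen)).trans hemit).mono (by omega)

theorem binValue_replicate_false (n : ℕ) : binValue (List.replicate n false ++ [true]) = 2 ^ n := by
  induction n with
  | zero => rfl
  | succ n ih =>
    rw [List.replicate_succ, List.cons_append, binValue_cons, ih, Nat.bit_false, pow_succ']

theorem representsRat_encodeWeight (l : ℕ) (kind : Option Bool) :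
    RepresentsRat (encodeWeight l kind) ((binValue [kind.isSome] : ℚ) / (2 ^ rate kind) ^ l) := by
  refine ⟨_, _, rfl, ?_, ?_⟩
  · rw [binValue_replicate_false]
    positivity
  · rw [binValue_replicate_false, Nat.cast_pow, Nat.cast_ofNat, pow_mul]

theorem coe_kindWeight (l : ℕ) (kind : Option Bool) :
    (((binValue [kind.isSome] : ℚ) / (2 ^ rate kind) ^ l : ℚ) : ℝ) = kindWeight l kind := by
  rcases kind with _ | _ | _
  · simp [kindWeight, binValue]
  · norm_num [kindWeight, binValue, rate, div_pow]
  · norm_num [kindWeight, binValue, rate, div_pow]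

end WeightMachine

theorem monotone_eval_nat (p : Polynomial ℕ) : Monotone fun n => p.eval n := by
  intro a b h
  simp only [Polynomial.eval_eq_sum, Polynomial.sum]
  gcongr

theorem efficientlyComputable_verifierWeight {V : TM2ComputableAux (Option Bool) Bool}
    {v : List Bool → List Bool → Bool} {t : Polynomial ℕ}
    (hV : ∀ x w, Computes V (pairEnc x w) [v x w] (t.eval (x.length + w.length))) :
    EfficientlyComputable (verifierWeight v) :=
  ⟨WeightMachine.machine V, t + 4 * Polynomial.X + 6, fun y => ⟨_, _,
    by simpa using WeightMachine.computes (monotone_eval_nat t) hV y,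
    WeightMachine.representsRat_encodeWeight _ _, WeightMachine.coe_kindWeight _ _⟩⟩

end LocalNorm

theorem theorem2 (hNP : ¬ LocalNorm.NP ⊆ LocalNorm.PPoly) :
    ∃ p : LocalNorm.WeightedLanguage,
      LocalNorm.Normalizable p ∧ LocalNorm.EfficientlyComputable p ∧
      ∀ lam : ℝ, 1 ≤ lam →
        ¬ ∃ (M : Turing.TM2ComputableAux Bool Bool) (θ : ℕ → List Bool),
          LocalNorm.ApproximatelyLocallyNormalizes lam p M θ := by
  obtain ⟨L, ⟨V, v, w, t, hV, hL⟩, hLP⟩ := Set.not_subset.1 hNP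
  refine ⟨LocalNorm.verifierWeight v, LocalNorm.normalizable_verifierWeight v,
    LocalNorm.efficientlyComputable_verifierWeight hV, ?_⟩
  rintro lam hlam ⟨M, θ, h⟩
  obtain ⟨j, hj⟩ := pow_unbounded_of_one_lt lam one_lt_two
  have hheader : LocalNorm.PolyBounded fun n =>
      (LocalNorm.header (2 * j + 1) (w.eval n)).length := by
    simp only [LocalNorm.length_header]
    exact ((LocalNorm.PolyBounded.const _).add (.eval w)).add (.const 2)
  refine hLP (LocalNorm.mem_PPoly_of_approximatelyLocallyNormalizes h (zero_lt_one.trans_le hlam)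
    hj.le hheader (fun x => LocalNorm.localProb_query_pos v _ _ x) (fun x hx => ?_) fun x hx => ?_)
  · obtain ⟨z, hz, hvz⟩ := (hL x).1 hx
    exact LocalNorm.localProb_query_mul_le_one _ hz hvz
  · refine LocalNorm.localProb_query_eq_one _ fun z hz => ?_
    exact Bool.eq_false_of_not_eq_true fun hvz => hx ((hL x).2 ⟨z, hz, hvz⟩)
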